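/- \textbf{Setting.} Let $m\ge 0$, $\Lambda\ge 0$, $\Omega=(-\infty,-\Lambda)\cup(\Lambda,\infty)$ and $\mathcal H=\mathbb C^2\otimes L^2(\Omega)\cong L^2(\Omega)\oplus L^2(\Omega)$, with $\psi=(\psi_\uparrow,\psi_\downarrow)$. Let $AC^1$ be the space of $f\in L^2(\Omega)$ that are absolutely continuous on each of the closed half-lines $(-\infty,-\Lambda]$ and $[\Lambda,\infty)$ (with separate one-sided boundary values $f(-\Lambda)$ and $f(+\Lambda)$, also when $\Lambda=0$) and have $f'\in L^2(\Omega)$; let $AC^1_0$ be the subspace of those with $f(-\Lambda)=f(+\Lambda)=0$. The minimal Dirac operator is $H_0=\sigma_x\otimes(-i\,\frac{d}{dx})+m\,\sigma_z\otimes 1$ with $D(H_0)=\mathbb C^2\otimes AC^1_0$; $H_0^*$ is its adjoint and $\mathcal K_\pm=\ker(\pm i-H_0^*)$ are its deficiency subspaces. Put $\mu=(1+im)/\sqrt{1+m^2}$, $N=(1+m^2)^{1/4}e^{\sqrt{1+m^2}\,\Lambda}$ and, with $\chi_L,\chi_R$ the characteristic functions of $(-\infty,-\Lambda]$ and $[\Lambda,\infty)$,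 $$\psi_L^+=N\binom{1}{-\mu}\chi_L e^{\sqrt{1+m^2}\,x},\quad \psi_R^+=N\binom{1}{\mu}\chi_R e^{-\sqrt{1+m^2}\,x},\quad \psi_L^-=N\binom{1}{\mu^*}\chi_L e^{\sqrt{1+m^2}\,x},\quad \psi_R^-=N\binom{1}{-\mu^*}\chi_R e^{-\sqrt{1+m^2}\,x}.$$ A unitary operator $U:\mathcal K_+\to\mathcal K_-$ is identified with the matrix $(u_{jk})\in U(2)$ given by $U\psi_L^+=u_{11}\psi_L^-+u_{12}\psi_R^-$, $U\psi_R^+=u_{21}\psi_L^-+u_{22}\psi_R^-$, and $H_U$ is the restriction of $H_0^*$ to $$D(H_U)=\{\psi_0+\psi^++U\psi^+ : \psi_0\in D(H_0),\ \psi^+\in\mathcal K_+\}.$$ For $\alpha=(\alpha_1,\alpha_2,\alpha_3,\alpha_4)\in\mathbb C^4$ satisfying $$\Re(\alpha_1\alpha_2^*)=\Re(\alpha_1\alpha_3^*)=\Re(\alpha_2\alpha_4^*)=\Re(\alpha_3\alpha_4^*)=0,\qquad \alpha_1\alpha_4^*+\alpha_2\alpha_3^*=\alpha_1\alpha_4^*+\alpha_2^*\alpha_3=1,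 \tag{C}$$ let $B_\alpha=\begin{pmatrix}\alpha_1&\alpha_2\\ \alpha_3&\alpha_4\end{pmatrix}$ and let $H_\alpha$ be the restriction of $H_0^*$ to $D(H_\alpha)=\{\psi\in D(H_0^*) : \psi(+\Lambda)=B_\alpha\psi(-\Lambda)\}$. \textbf{Proposition.} Let $\alpha$ satisfy (C). Let $\theta_\alpha\in[0,2\pi)$ be the argument of $\alpha_1/|\alpha_1|$ if $\alpha_1\neq 0$, and of $-i\alpha_3/|\alpha_3|$ if $\alpha_1=0$. Then $\theta=\theta_\alpha$ has the property that there are real $a_1,\dots,a_4$ with $$\alpha_j=e^{i\theta}a_j\ (j=1,4),\qquad \alpha_k=ie^{i\theta}a_k\ (k=2,3). \tag{P}$$ For $\theta=\theta_\alpha$, and more generally for every $\theta\in\mathbb R$ with property (P), put $$\Gamma_0=\Bigl(\tfrac{4}{1+m^2}+\bigl|-\mu^*\alpha_1+\alpha_2-\alpha_3+\mu\alpha_4\bigr|^2\Bigr)^{-1/2},$$ $$\gamma_1=\Gamma_0e^{-i(\theta-\pi/2)}\bigl(-\mu^*\alpha_1+\alpha_2-\alpha_3+\mu\alpha_4\bigr),\qquad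 \gamma_2=\tfrac{2}{\sqrt{1+m^2}}\,\Gamma_0e^{-i(\theta-\pi/2)},$$ $$\gamma_3=\Gamma_0e^{i(\theta-\pi/2)}\mu\bigl(\alpha_1+\mu^*\alpha_2+\mu\alpha_3+\alpha_4\bigr)^*.$$ Then $|\gamma_1|^2+|\gamma_2|^2=|\gamma_3|=1$ and $\gamma_2\neq 0$; the matrix $$U=\gamma_3\begin{pmatrix}\gamma_1&-\gamma_2^*\\ \gamma_2&\gamma_1^*\end{pmatrix}$$ is a non-diagonal element of $U(2)$, it is the matrix of exactly one unitary operator $\mathcal K_+\to\mathcal K_-$, and this operator is the one and only unitary $V:\mathcal K_+\to\mathcal K_-$ with $D(H_V)=D(H_\alpha)$. -/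

import Mathlib

open MeasureTheory Set Complex
open scoped ComplexConjugate NNReal ENNReal

noncomputable section

namespace DiracJunction

/-! ### Deficiency subspaces and von Neumann's domains -/

section VonNeumann

variable {H : Type*} [NormedAddCommGroup H] [InnerProductSpace ℂ H] [CompleteSpace H]

/-- The subspace `ker (z - A*)` of `H`, where `A*` is the adjoint of the operator `A`. -/
def adjointEigenspace (A : H →ₗ.[ℂ] H) (z : ℂ) : Submodule ℂ H :=
  (LinearMap.ker (z • A.adjoint.domain.subtype - A.adjoint.toFun)).map A.adjoint.domain.subtype

/-- The deficiency subspace `K₊(A) = ker (i - A*)`. -/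
abbrev deficiencyPlus (A : H →ₗ.[ℂ] H) : Submodule ℂ H := adjointEigenspace A I

/-- The deficiency subspace `K₋(A) = ker (-i - A*)`. -/
abbrev deficiencyMinus (A : H →ₗ.[ℂ] H) : Submodule ℂ H := adjointEigenspace A (-I)

/-- The domain `{ψ₀ + ψ⁺ + U ψ⁺ | ψ₀ ∈ D(A), ψ⁺ ∈ K₊(A)}` of the extension `A_U` of `A` that
corresponds to the unitary operator `U : K₊(A) → K₋(A)`; the extension itself is the restriction
of `A*` to this domain. -/
def vonNeumannDomain (A : H →ₗ.[ℂ] H) (U : deficiencyPlus A ≃ₗᵢ[ℂ] deficiencyMinus A) :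
    Submodule ℂ H where
  carrier := {ψ | ∃ ψ₀ ∈ A.domain, ∃ φ : deficiencyPlus A, ψ = ψ₀ + (φ : H) + (U φ : H)}
  add_mem' := by
    rintro _ _ ⟨a, ha, φ, rfl⟩ ⟨b, hb, χ, rfl⟩
    refine ⟨a + b, A.domain.add_mem ha hb, φ + χ, ?_⟩
    simp only [map_add, Submodule.coe_add]
    abel
  zero_mem' := ⟨0, A.domain.zero_mem, 0, by simp⟩
  smul_mem' := by
    rintro c _ ⟨a, ha, φ, rfl⟩
    exact ⟨c • a, A.domain.smul_mem c ha, c • φ, by simp [smul_add]⟩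

end VonNeumann

/-! ### The configuration space and its function spaces -/

/-- The configuration space `Ω = (-∞, -Λ) ∪ (Λ, ∞)`. -/
def Omega (L : ℝ≥0) : Set ℝ := Iio (-(L : ℝ)) ∪ Ioi (L : ℝ)

/-- The Hilbert space `L²(Ω)`. -/
abbrev L2 (L : ℝ≥0) : Type := Lp ℂ 2 (volume.restrict (Omega L))

/-- The Hilbert space `ℂ² ⊗ L²(Ω) ≅ L²(Ω) ⊕ L²(Ω)`; the two components of a wave function are its
up-spin part `ψ.fst` and its down-spin part `ψ.snd`. -/
abbrev WaveSpace (L : ℝ≥0) : Type := WithLp 2 (L2 L × L2 L)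

/-- `f` agrees a.e. on the left and on the right half-line with the functions `FL` and `FR`, which
are absolutely continuous on the (compact parts of the) closed half-lines `(-∞, -Λ]` and `[Λ, ∞)`,
and `g` is the derivative of `f` a.e. on `Ω`.  The boundary values of `f` are `FL (-Λ)` and
`FR Λ`; two functions are used so that both values make sense when `Λ = 0`. -/
structure HasACDeriv (L : ℝ≥0) (f g : L2 L) (FL FR : ℝ → ℂ) : Prop where
  ac_left : ∀ a : ℝ, a ≤ -(L : ℝ) → AbsolutelyContinuousOnInterval FL a (-(L : ℝ))
  ac_right : ∀ b : ℝ, (L : ℝ) ≤ b → AbsolutelyContinuousOnInterval FR (L : ℝ) b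
  eq_left : ∀ᵐ x : ℝ, x < -(L : ℝ) → f x = FL x
  eq_right : ∀ᵐ x : ℝ, (L : ℝ) < x → f x = FR x
  deriv_left : ∀ᵐ x : ℝ, x < -(L : ℝ) → HasDerivAt FL (g x) x
  deriv_right : ∀ᵐ x : ℝ, (L : ℝ) < x → HasDerivAt FR (g x) x

section Basic

variable {L : ℝ≥0}

theorem ae_of_ae_restrict {p : ℝ → Prop} (h : ∀ᵐ x ∂(volume.restrict (Omega L)), p x) :
    ∀ᵐ x : ℝ, x ∈ Omega L → p x :=
  (ae_restrict_iff' (measurableSet_Iio.union measurableSet_Ioi)).1 h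

theorem HasACDeriv.zero : HasACDeriv L 0 0 0 0 := by
  have h : ∀ᵐ x : ℝ, x ∈ Omega L → (0 : L2 L) x = 0 :=
    ae_of_ae_restrict (Lp.coeFn_zero ℂ 2 (volume.restrict (Omega L)))
  have hac : ∀ a b : ℝ, AbsolutelyContinuousOnInterval (0 : ℝ → ℂ) a b := fun a b =>
    (contDiff_const (c := (0 : ℂ))).contDiffOn.absolutelyContinuousOnInterval
  refine ⟨fun a _ => hac _ _, fun b _ => hac _ _, ?_, ?_, ?_, ?_⟩
  · filter_upwards [h] with x hx h1 using hx (Or.inl h1)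
  · filter_upwards [h] with x hx h1 using hx (Or.inr h1)
  · filter_upwards [h] with x hx h1
    rw [hx (Or.inl h1)]
    exact hasDerivAt_const x (0 : ℂ)
  · filter_upwards [h] with x hx h1
    rw [hx (Or.inr h1)]
    exact hasDerivAt_const x (0 : ℂ)

theorem HasACDeriv.add {f g f' g' : L2 L} {FL FR FL' FR' : ℝ → ℂ}
    (h : HasACDeriv L f g FL FR) (h' : HasACDeriv L f' g' FL' FR') :
    HasACDeriv L (f + f') (g + g') (FL + FL') (FR + FR') := by
  have hf : ∀ᵐ x : ℝ, x ∈ Omega L → (f + f') x = f x + f' x :=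
    ae_of_ae_restrict (Lp.coeFn_add f f')
  have hg : ∀ᵐ x : ℝ, x ∈ Omega L → (g + g') x = g x + g' x :=
    ae_of_ae_restrict (Lp.coeFn_add g g')
  refine ⟨fun a ha => (h.ac_left a ha).add (h'.ac_left a ha),
    fun b hb => (h.ac_right b hb).add (h'.ac_right b hb), ?_, ?_, ?_, ?_⟩
  · filter_upwards [hf, h.eq_left, h'.eq_left] with x h0 h1 h2 hx
    rw [h0 (Or.inl hx), h1 hx, h2 hx, Pi.add_apply]
  · filter_upwards [hf, h.eq_right, h'.eq_right] with x h0 h1 h2 hx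
    rw [h0 (Or.inr hx), h1 hx, h2 hx, Pi.add_apply]
  · filter_upwards [hg, h.deriv_left, h'.deriv_left] with x h0 h1 h2 hx
    rw [h0 (Or.inl hx)]
    exact (h1 hx).add (h2 hx)
  · filter_upwards [hg, h.deriv_right, h'.deriv_right] with x h0 h1 h2 hx
    rw [h0 (Or.inr hx)]
    exact (h1 hx).add (h2 hx)

theorem HasACDeriv.smul {f g : L2 L} {FL FR : ℝ → ℂ} (c : ℂ) (h : HasACDeriv L f g FL FR) :
    HasACDeriv L (c • f) (c • g) (c • FL) (c • FR) := by
  have hf : ∀ᵐ x : ℝ, x ∈ Omega L → (c • f) x = c • f x :=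
    ae_of_ae_restrict (Lp.coeFn_smul c f)
  have hg : ∀ᵐ x : ℝ, x ∈ Omega L → (c • g) x = c • g x :=
    ae_of_ae_restrict (Lp.coeFn_smul c g)
  refine ⟨fun a ha => (h.ac_left a ha).const_smul c, fun b hb => (h.ac_right b hb).const_smul c,
    ?_, ?_, ?_, ?_⟩
  · filter_upwards [hf, h.eq_left] with x h0 h1 hx
    rw [h0 (Or.inl hx), h1 hx, Pi.smul_apply]
  · filter_upwards [hf, h.eq_right] with x h0 h1 hx
    rw [h0 (Or.inr hx), h1 hx, Pi.smul_apply]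
  · filter_upwards [hg, h.deriv_left] with x h0 h1 hx
    rw [h0 (Or.inl hx)]
    exact (h1 hx).const_smul c
  · filter_upwards [hg, h.deriv_right] with x h0 h1 hx
    rw [h0 (Or.inr hx)]
    exact (h1 hx).const_smul c

/-- Two functions that are continuous on an open set and agree a.e. there agree everywhere
there. -/
theorem eqOn_of_ae {s : Set ℝ} (hs : IsOpen s) {F G : ℝ → ℂ} (hF : ContinuousOn F s)
    (hG : ContinuousOn G s) (h : ∀ᵐ x : ℝ, x ∈ s → F x = G x) : EqOn F G s :=
  Measure.eqOn_open_of_ae_eq ((ae_restrict_iff' hs.measurableSet).2 h) hs hF hG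

theorem HasACDeriv.continuousOn_left {f g : L2 L} {FL FR : ℝ → ℂ} (h : HasACDeriv L f g FL FR) :
    ContinuousOn FL (Iio (-(L : ℝ))) := by
  intro x hx
  have hx' : x < -(L : ℝ) := hx
  have := (h.ac_left (x - 1) (by linarith)).continuousOn
  rw [uIcc_of_le (by linarith)] at this
  exact (this.continuousAt (Icc_mem_nhds (by linarith) hx')).continuousWithinAt

theorem HasACDeriv.continuousOn_right {f g : L2 L} {FL FR : ℝ → ℂ} (h : HasACDeriv L f g FL FR) :
    ContinuousOn FR (Ioi (L : ℝ)) := by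
  intro x hx
  have hx' : (L : ℝ) < x := hx
  have := (h.ac_right (x + 1) (by linarith)).continuousOn
  rw [uIcc_of_le (by linarith)] at this
  exact (this.continuousAt (Icc_mem_nhds hx' (by linarith))).continuousWithinAt

/-- The derivative is determined by the function. -/
theorem HasACDeriv.unique {f g g' : L2 L} {FL FR FL' FR' : ℝ → ℂ}
    (h : HasACDeriv L f g FL FR) (h' : HasACDeriv L f g' FL' FR') : g = g' := by
  have hL : EqOn FL FL' (Iio (-(L : ℝ))) := by
    refine eqOn_of_ae isOpen_Iio h.continuousOn_left h'.continuousOn_left ?_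
    filter_upwards [h.eq_left, h'.eq_left] with x h1 h2 hx
    rw [← h1 hx, h2 hx]
  have hR : EqOn FR FR' (Ioi (L : ℝ)) := by
    refine eqOn_of_ae isOpen_Ioi h.continuousOn_right h'.continuousOn_right ?_
    filter_upwards [h.eq_right, h'.eq_right] with x h1 h2 hx
    rw [← h1 hx, h2 hx]
  refine Lp.ext ((ae_restrict_iff' (measurableSet_Iio.union measurableSet_Ioi)).2 ?_)
  filter_upwards [h.deriv_left, h'.deriv_left, h.deriv_right, h'.deriv_right]
    with x h1 h2 h3 h4 hx
  rcases hx with hx | hx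
  · exact (h1 hx).unique ((h2 hx).congr_of_eventuallyEq (hL.eventuallyEq_of_mem (Iio_mem_nhds hx)))
  · exact (h3 hx).unique ((h4 hx).congr_of_eventuallyEq (hR.eventuallyEq_of_mem (Ioi_mem_nhds hx)))

end Basic

/-- The space `AC¹` of the (classes of) functions in `L²(Ω)` that are absolutely continuous on the
closed half-lines and whose derivative is in `L²(Ω)`. -/
def AC (L : ℝ≥0) : Submodule ℂ (L2 L) where
  carrier := {f | ∃ g FL FR, HasACDeriv L f g FL FR}
  add_mem' := by
    rintro _ _ ⟨_, _, _, h⟩ ⟨_, _, _, h'⟩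
    exact ⟨_, _, _, h.add h'⟩
  zero_mem' := ⟨_, _, _, HasACDeriv.zero⟩
  smul_mem' := by
    rintro c _ ⟨_, _, _, h⟩
    exact ⟨_, _, _, h.smul c⟩

/-- The space `AC¹₀` of the functions in `AC¹` whose boundary values at `-Λ` and `Λ` vanish. -/
def AC0 (L : ℝ≥0) : Submodule ℂ (L2 L) where
  carrier := {f | ∃ g FL FR, HasACDeriv L f g FL FR ∧ FL (-(L : ℝ)) = 0 ∧ FR (L : ℝ) = 0}
  add_mem' := by
    rintro _ _ ⟨_, _, _, h, h1, h2⟩ ⟨_, _, _, h', h1', h2'⟩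
    exact ⟨_, _, _, h.add h', by simp [h1, h1'], by simp [h2, h2']⟩
  zero_mem' := ⟨_, _, _, HasACDeriv.zero, rfl, rfl⟩
  smul_mem' := by
    rintro c _ ⟨_, _, _, h, h1, h2⟩
    exact ⟨_, _, _, h.smul c, by simp [h1], by simp [h2]⟩

theorem AC0_le_AC (L : ℝ≥0) : AC0 L ≤ AC L := by
  rintro _ ⟨_, _, _, h, _⟩
  exact ⟨_, _, _, h⟩

/-- The derivative `d/dx : AC¹ → L²(Ω)`. -/
def ddx (L : ℝ≥0) : AC L →ₗ[ℂ] L2 L where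
  toFun f := f.2.choose
  map_add' := by
    intro f f'
    obtain ⟨_, _, h⟩ := f.2.choose_spec
    obtain ⟨_, _, h'⟩ := f'.2.choose_spec
    obtain ⟨_, _, h''⟩ := (f + f').2.choose_spec
    exact h''.unique (h.add h')
  map_smul' := by
    intro c f
    obtain ⟨_, _, h⟩ := f.2.choose_spec
    obtain ⟨_, _, h''⟩ := (c • f).2.choose_spec
    exact h''.unique (h.smul c)

/-! ### The Dirac operators -/

/-- The domain `ℂ² ⊗ AC¹₀` of the minimal Dirac operator. -/
def minimalDomain (L : ℝ≥0) : Submodule ℂ (WaveSpace L) where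
  carrier := {ψ | ψ.fst ∈ AC0 L ∧ ψ.snd ∈ AC0 L}
  add_mem' := fun h h' => ⟨(AC0 L).add_mem h.1 h'.1, (AC0 L).add_mem h.2 h'.2⟩
  zero_mem' := ⟨(AC0 L).zero_mem, (AC0 L).zero_mem⟩
  smul_mem' := fun c _ h => ⟨(AC0 L).smul_mem c h.1, (AC0 L).smul_mem c h.2⟩

/-- The momentum operator `p = -i d/dx` with domain `AC¹₀`. -/
def momentum (L : ℝ≥0) : L2 L →ₗ.[ℂ] L2 L where
  domain := AC0 L
  toFun := (-I) • (ddx L ∘ₗ Submodule.inclusion (AC0_le_AC L))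

/-- The minimal Dirac operator `H₀ = σ_x ⊗ p + m σ_z ⊗ 1` with domain `ℂ² ⊗ AC¹₀`. -/
def minimalDirac (m : ℝ) (L : ℝ≥0) : WaveSpace L →ₗ.[ℂ] WaveSpace L where
  domain := minimalDomain L
  toFun :=
    { toFun := fun ψ => WithLp.toLp 2
        (momentum L ⟨ψ.1.snd, ψ.2.2⟩ + (m : ℂ) • ψ.1.fst,
         momentum L ⟨ψ.1.fst, ψ.2.1⟩ - (m : ℂ) • ψ.1.snd)
      map_add' := by
        intro ψ φ
        have h1 : (⟨(ψ + φ).1.snd, (ψ + φ).2.2⟩ : (momentum L).domain)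
            = ⟨ψ.1.snd, ψ.2.2⟩ + ⟨φ.1.snd, φ.2.2⟩ := rfl
        have h2 : (⟨(ψ + φ).1.fst, (ψ + φ).2.1⟩ : (momentum L).domain)
            = ⟨ψ.1.fst, ψ.2.1⟩ + ⟨φ.1.fst, φ.2.1⟩ := rfl
        rw [h1, h2, LinearPMap.map_add, LinearPMap.map_add, ← WithLp.toLp_add, Prod.mk_add_mk]
        congr 2
        · rw [Submodule.coe_add, WithLp.add_fst, smul_add]; abel
        · rw [Submodule.coe_add, WithLp.add_snd, smul_add]; abel
      map_smul' := by
        intro c ψ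
        have h1 : (⟨(c • ψ).1.snd, (c • ψ).2.2⟩ : (momentum L).domain)
            = c • ⟨ψ.1.snd, ψ.2.2⟩ := rfl
        have h2 : (⟨(c • ψ).1.fst, (c • ψ).2.1⟩ : (momentum L).domain)
            = c • ⟨ψ.1.fst, ψ.2.1⟩ := rfl
        rw [h1, h2, LinearPMap.map_smul, LinearPMap.map_smul, RingHom.id_apply,
          ← WithLp.toLp_smul, Prod.smul_mk]
        congr 2
        · rw [Submodule.coe_smul, WithLp.smul_fst, smul_add, smul_comm c]
        · rw [Submodule.coe_smul, WithLp.smul_snd, smul_sub, smul_comm c] }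

/-- The maximal Dirac operator `H₀*`. -/
abbrev maximalDirac (m : ℝ) (L : ℝ≥0) : WaveSpace L →ₗ.[ℂ] WaveSpace L :=
  (minimalDirac m L).adjoint

/-- `vL = (ψ_↑(-Λ), ψ_↓(-Λ))` and `vR = (ψ_↑(Λ), ψ_↓(Λ))` are the boundary values of the
absolutely continuous wave function `ψ`. -/
def HasBoundaryValues {L : ℝ≥0} (ψ : WaveSpace L) (vL vR : Fin 2 → ℂ) : Prop :=
  ∃ (gu gd : L2 L) (UL UR DL DR : ℝ → ℂ),
    HasACDeriv L ψ.fst gu UL UR ∧ HasACDeriv L ψ.snd gd DL DR ∧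
    vL = ![UL (-(L : ℝ)), DL (-(L : ℝ))] ∧ vR = ![UR (L : ℝ), DR (L : ℝ)]

/-- The class of the vectors `α = (α₁, α₂, α₃, α₄)` (with indices `0, 1, 2, 3` here). -/
structure InClass (α : Fin 4 → ℂ) : Prop where
  re12 : (α 0 * conj (α 1)).re = 0
  re13 : (α 0 * conj (α 2)).re = 0
  re24 : (α 1 * conj (α 3)).re = 0
  re34 : (α 2 * conj (α 3)).re = 0
  one : α 0 * conj (α 3) + α 1 * conj (α 2) = 1
  one' : α 0 * conj (α 3) + conj (α 1) * α 2 = 1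

/-- The boundary matrix `B_α`. -/
def boundaryMatrix (α : Fin 4 → ℂ) : Matrix (Fin 2) (Fin 2) ℂ := !![α 0, α 1; α 2, α 3]

/-- The domain `D(H_α) = {ψ ∈ D(H₀*) | ψ(Λ) = B_α ψ(-Λ)}`. -/
def alphaDomain (m : ℝ) (L : ℝ≥0) (α : Fin 4 → ℂ) : Submodule ℂ (WaveSpace L) where
  carrier := {ψ | ψ ∈ (maximalDirac m L).domain ∧
    ∃ vL vR, HasBoundaryValues ψ vL vR ∧ vR = (boundaryMatrix α).mulVec vL}
  add_mem' := by
    rintro ψ φ ⟨hψ, _, _, ⟨_, _, _, _, _, _, h1, h2, rfl, rfl⟩, e⟩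
      ⟨hφ, _, _, ⟨_, _, _, _, _, _, h1', h2', rfl, rfl⟩, e'⟩
    refine ⟨Submodule.add_mem _ hψ hφ, _, _,
      ⟨_, _, _, _, _, _, h1.add h1', h2.add h2', rfl, rfl⟩, ?_⟩
    have := congrArg₂ (· + ·) e e'
    simp only [← Matrix.mulVec_add] at this
    simpa using this
  zero_mem' := by
    refine ⟨Submodule.zero_mem _, _, _,
      ⟨_, _, _, _, _, _, HasACDeriv.zero, HasACDeriv.zero, rfl, rfl⟩, ?_⟩
    funext i
    fin_cases i <;> simp [boundaryMatrix, Matrix.mulVec, dotProduct]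
  smul_mem' := by
    rintro c ψ ⟨hψ, _, _, ⟨_, _, _, _, _, _, h1, h2, rfl, rfl⟩, e⟩
    refine ⟨Submodule.smul_mem _ c hψ, _, _,
      ⟨_, _, _, _, _, _, h1.smul c, h2.smul c, rfl, rfl⟩, ?_⟩
    have := congrArg (c • ·) e
    simp only [← Matrix.mulVec_smul] at this
    simpa using this

/-! ### The bases of the deficiency subspaces -/

/-- The constant `κ = √(1 + m²)`. -/
def kappa (m : ℝ) : ℝ := √(1 + m ^ 2)

/-- The constant `μ = (1 + i m) / √(1 + m²)`. -/
def mu (m : ℝ) : ℂ := (1 + I * m) / kappa m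

/-- The normalizing constant `N = (1 + m²)^{1/4} e^{κ Λ}`. -/
def normConst (m : ℝ) (L : ℝ≥0) : ℝ := (1 + m ^ 2) ^ (1 / 4 : ℝ) * Real.exp (kappa m * L)

theorem kappa_pos (m : ℝ) : 0 < kappa m := Real.sqrt_pos.2 (by positivity)

/-- `χ_L(x) e^{κ x}` -/
def leftExp (m : ℝ) (L : ℝ≥0) : ℝ → ℂ :=
  (Iic (-(L : ℝ))).indicator fun x => (Real.exp (kappa m * x) : ℂ)

/-- `χ_R(x) e^{-κ x}` -/
def rightExp (m : ℝ) (L : ℝ≥0) : ℝ → ℂ :=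
  (Ici (L : ℝ)).indicator fun x => (Real.exp (-kappa m * x) : ℂ)

theorem memLp_leftExp (m : ℝ) (L : ℝ≥0) :
    MemLp (leftExp m L) 2 (volume.restrict (Omega L)) := by
  refine MemLp.restrict _ ((memLp_indicator_iff_restrict measurableSet_Iic).2 ?_)
  refine (memLp_two_iff_integrable_sq_norm (by fun_prop)).2 ?_
  have h := integrableOn_exp_mul_Iic (a := 2 * kappa m) (by linarith [kappa_pos m]) (-(L : ℝ))
  refine h.congr (Filter.Eventually.of_forall fun x => ?_)
  simp only [Complex.norm_real, Real.norm_eq_abs, sq_abs, ← Real.exp_nat_mul]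
  push_cast
  ring_nf

theorem memLp_rightExp (m : ℝ) (L : ℝ≥0) :
    MemLp (rightExp m L) 2 (volume.restrict (Omega L)) := by
  refine MemLp.restrict _ ((memLp_indicator_iff_restrict measurableSet_Ici).2 ?_)
  refine (memLp_two_iff_integrable_sq_norm (by fun_prop)).2 ?_
  have h := (integrableOn_Ici_iff_integrableOn_Ioi).2
    (integrableOn_exp_mul_Ioi (a := -2 * kappa m) (by linarith [kappa_pos m]) (L : ℝ))
  refine h.congr (Filter.Eventually.of_forall fun x => ?_)
  simp only [Complex.norm_real, Real.norm_eq_abs, sq_abs, ← Real.exp_nat_mul]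
  push_cast
  ring_nf

/-- The wave function `N (1, z) ⊗ χ_L e^{κ x}`. -/
def leftState (m : ℝ) (L : ℝ≥0) (z : ℂ) : WaveSpace L :=
  (normConst m L : ℂ) • WithLp.toLp 2
    ((memLp_leftExp m L).toLp (leftExp m L), z • (memLp_leftExp m L).toLp (leftExp m L))

/-- The wave function `N (1, z) ⊗ χ_R e^{-κ x}`. -/
def rightState (m : ℝ) (L : ℝ≥0) (z : ℂ) : WaveSpace L :=
  (normConst m L : ℂ) • WithLp.toLp 2
    ((memLp_rightExp m L).toLp (rightExp m L), z • (memLp_rightExp m L).toLp (rightExp m L))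

/-- `ψ_L⁺` -/
def psiLPlus (m : ℝ) (L : ℝ≥0) : WaveSpace L := leftState m L (-mu m)

/-- `ψ_R⁺` -/
def psiRPlus (m : ℝ) (L : ℝ≥0) : WaveSpace L := rightState m L (mu m)

/-- `ψ_L⁻` -/
def psiLMinus (m : ℝ) (L : ℝ≥0) : WaveSpace L := leftState m L (conj (mu m))

/-- `ψ_R⁻` -/
def psiRMinus (m : ℝ) (L : ℝ≥0) : WaveSpace L := rightState m L (-conj (mu m))

/-- The unitary operator `V : K₊(H₀) → K₋(H₀)` has the matrix `U = (u_jk)` in the bases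
`(ψ_L⁺, ψ_R⁺)` and `(ψ_L⁻, ψ_R⁻)`: `V ψ_L⁺ = u₁₁ ψ_L⁻ + u₁₂ ψ_R⁻` and
`V ψ_R⁺ = u₂₁ ψ_L⁻ + u₂₂ ψ_R⁻`. -/
def HasMatrix {m : ℝ} {L : ℝ≥0}
    (V : deficiencyPlus (minimalDirac m L) ≃ₗᵢ[ℂ] deficiencyMinus (minimalDirac m L))
    (U : Matrix (Fin 2) (Fin 2) ℂ) : Prop :=
  (∃ h : psiLPlus m L ∈ deficiencyPlus (minimalDirac m L),
    (V ⟨_, h⟩ : WaveSpace L) = U 0 0 • psiLMinus m L + U 0 1 • psiRMinus m L) ∧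
  (∃ h : psiRPlus m L ∈ deficiencyPlus (minimalDirac m L),
    (V ⟨_, h⟩ : WaveSpace L) = U 1 0 • psiLMinus m L + U 1 1 • psiRMinus m L)

/-! ### The explicit formulae -/

/-- `θ` is a phase of `α`: `α_j = e^{iθ} a_j` for `j = 1, 4` and `α_k = i e^{iθ} a_k` for
`k = 2, 3`, with real numbers `a₁, a₂, a₃, a₄`. -/
def IsPhase (α : Fin 4 → ℂ) (θ : ℝ) : Prop :=
  ∃ a : Fin 4 → ℝ, α 0 = cexp (I * θ) * a 0 ∧ α 1 = I * cexp (I * θ) * a 1 ∧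
    α 2 = I * cexp (I * θ) * a 2 ∧ α 3 = cexp (I * θ) * a 3

/-- The argument of `α₁/|α₁|` in `[0, 2π)` if `α₁ ≠ 0`, and that of `-i α₃/|α₃|` if `α₁ = 0`. -/
def phase (α : Fin 4 → ℂ) : ℝ :=
  toIcoMod Real.two_pi_pos 0
    (arg (if α 0 = 0 then -I * α 2 / ‖α 2‖ else α 0 / ‖α 0‖))

/-- The combination `-μ* α₁ + α₂ - α₃ + μ α₄`. -/
def sigmaOne (m : ℝ) (α : Fin 4 → ℂ) : ℂ := -conj (mu m) * α 0 + α 1 - α 2 + mu m * α 3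

/-- The normalizing constant `Γ₀ = (4/(1+m²) + |-μ* α₁ + α₂ - α₃ + μ α₄|²)^{-1/2}`. -/
def Gamma0 (m : ℝ) (α : Fin 4 → ℂ) : ℝ :=
  (4 / (1 + m ^ 2) + ‖sigmaOne m α‖ ^ 2) ^ (-1 / 2 : ℝ)

/-- `γ₁ = Γ₀ e^{-i(θ-π/2)} (-μ* α₁ + α₂ - α₃ + μ α₄)` -/
def gamma1 (m : ℝ) (α : Fin 4 → ℂ) (θ : ℝ) : ℂ :=
  Gamma0 m α * cexp (-I * (θ - Real.pi / 2)) * sigmaOne m α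

/-- `γ₂ = (2/√(1+m²)) Γ₀ e^{-i(θ-π/2)}` -/
def gamma2 (m : ℝ) (α : Fin 4 → ℂ) (θ : ℝ) : ℂ :=
  2 / kappa m * Gamma0 m α * cexp (-I * (θ - Real.pi / 2))

/-- `γ₃ = Γ₀ e^{i(θ-π/2)} μ (α₁ + μ* α₂ + μ α₃ + α₄)*` -/
def gamma3 (m : ℝ) (α : Fin 4 → ℂ) (θ : ℝ) : ℂ :=
  Gamma0 m α * cexp (I * (θ - Real.pi / 2)) * mu m *
    conj (α 0 + conj (mu m) * α 1 + mu m * α 2 + α 3)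

/-- The matrix `γ₃ [[γ₁, -γ₂*], [γ₂, γ₁*]]`. -/
def quatMatrix (γ₁ γ₂ γ₃ : ℂ) : Matrix (Fin 2) (Fin 2) ℂ :=
  γ₃ • !![γ₁, -conj γ₂; γ₂, conj γ₁]

end DiracJunction

end

namespace DiracJunction

/-! ### Absolutely continuous complex functions and integration by parts -/

section RealAnalysis

open Filter Topology

/-! Everything is decided by boundary values. A wave function with absolutely continuous components
lies in D(H₀) exactly when both its boundary values vanish (`mem_minimalDomain_iff`), and it always
lies in D(H₀*) (`maximalDirac_apply`, by integration by parts). Each deficiency subspace has the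
left and the right exponential state as an orthonormal basis: a weak solution of the eigenvalue
equation splits into combinations e^{κx} and e^{-κx} on each half-line, and square integrability
leaves only the decaying ones (`exists_eq_of_mem_adjointEigenspace`). Hence all elements of D(H_V)
have explicit boundary values, and a full description of D(H₀*) is never needed.

The equality D(H_V) = D(H_α) thus becomes the condition v_R = B_α v_L for the boundary values of
ψ_L⁺ + Vψ_L⁺ and ψ_R⁺ + Vψ_R⁺. These are linear equations for the matrix entries of V, and
eliminating one unknown from each pair leaves the other multiplied by `tauOne`, that is τ = α₁ +
μ*α₂ + μα₃ + α₄, up to a unit factor (`boundary_unique`). So V is unique once τ ≠ 0.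

Condition (C) enters through the phase: with e = e^{iθ} one has α_j* e² = ±α_j and e² = det B_α
(`IsPhase.relations`). This removes conjugates of α and turns the claims into polynomial identities
in α, μ and μ* modulo μμ* = 1. The main one is |τ|² = 4/(1+m²) + |σ|², with σ = `sigmaOne`
(`tauOne_mul_conj`). It gives τ ≠ 0 and Γ₀ = 1/|τ|, makes the γ's correctly normalized, and shows
that the stated matrix solves the boundary equations (`quatMatrix_boundary`). Conversely every
boundary vector v_L is attained by some φ + Vφ because γ₂ ≠ 0, so the two domains coincide
(`vonNeumannDomain_eq_alphaDomain`). -/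

theorem AbsolutelyContinuousOnInterval.of_dist_le {X Y : Type*} [PseudoMetricSpace X]
    [PseudoMetricSpace Y] {F : ℝ → X} {G : ℝ → Y} {a b : ℝ}
    (hF : AbsolutelyContinuousOnInterval F a b) (h : ∀ x y, dist (G x) (G y) ≤ dist (F x) (F y)) :
    AbsolutelyContinuousOnInterval G a b :=
  squeeze_zero (fun _ => Finset.sum_nonneg fun _ _ => dist_nonneg)
    (fun _ => Finset.sum_le_sum fun _ _ => h _ _) hF

/-- The fundamental theorem of calculus for absolutely continuous complex functions. -/
theorem integral_eq_sub_of_absolutelyContinuous {F p : ℝ → ℂ} {a b : ℝ} (hab : a ≤ b)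
    (hF : AbsolutelyContinuousOnInterval F a b) (hp : IntervalIntegrable p volume a b)
    (hd : ∀ᵐ x : ℝ, x ∈ Ioo a b → HasDerivAt F (p x) x) :
    ∫ x in a..b, p x = F b - F a := by
  have hd' : ∀ᵐ x : ℝ, x ∈ uIoc a b → HasDerivAt F (p x) x := by
    have hb : ∀ᵐ x : ℝ, x ≠ b := by simp [ae_iff, measure_singleton]
    filter_upwards [hd, hb] with x hx hxb hm
    rw [uIoc_of_le hab] at hm
    exact hx ⟨hm.1, lt_of_le_of_ne hm.2 hxb⟩
  -- The real theorem is applied to the real and imaginary parts, which inherit absolute continuity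
  -- because taking either part does not increase distances.
  have hre : AbsolutelyContinuousOnInterval (fun x => (F x).re) a b :=
    AbsolutelyContinuousOnInterval.of_dist_le hF fun x y => by
      rw [Real.dist_eq, Complex.dist_eq, ← Complex.sub_re]
      exact Complex.abs_re_le_norm _
  have him : AbsolutelyContinuousOnInterval (fun x => (F x).im) a b :=
    AbsolutelyContinuousOnInterval.of_dist_le hF fun x y => by
      rw [Real.dist_eq, Complex.dist_eq, ← Complex.sub_im]
      exact Complex.abs_im_le_norm _
  have h1 := hre.integral_deriv_eq_sub
  have h2 := him.integral_deriv_eq_sub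
  have e1 : ∫ x in a..b, deriv (fun x => (F x).re) x = ∫ x in a..b, (p x).re := by
    refine intervalIntegral.integral_congr_ae ?_
    filter_upwards [hd'] with x hx hm
    exact (Complex.reCLM.hasFDerivAt.comp_hasDerivAt x (hx hm)).deriv
  have e2 : ∫ x in a..b, deriv (fun x => (F x).im) x = ∫ x in a..b, (p x).im := by
    refine intervalIntegral.integral_congr_ae ?_
    filter_upwards [hd'] with x hx hm
    exact (Complex.imCLM.hasFDerivAt.comp_hasDerivAt x (hx hm)).deriv
  have c1 : ∫ x in a..b, (p x).re = (∫ x in a..b, p x).re :=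
    Complex.reCLM.intervalIntegral_comp_comm hp
  have c2 : ∫ x in a..b, (p x).im = (∫ x in a..b, p x).im :=
    Complex.imCLM.intervalIntegral_comp_comm hp
  apply Complex.ext
  · rw [← c1, ← e1, h1, Complex.sub_re]
  · rw [← c2, ← e2, h2, Complex.sub_im]

/-- A nonzero limit would keep ‖F‖ above ‖c‖/2 on a half-line, which has infinite measure. This
removes the boundary term at infinity in the integrations by parts. -/
theorem integrableOn_tendsto_atTop_eq_zero {F : ℝ → ℂ} {a : ℝ} {c : ℂ}
    (hF : IntegrableOn F (Ioi a)) (h : Tendsto F atTop (𝓝 c)) : c = 0 := by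
  by_contra hc
  have hev : ∀ᶠ x in atTop, ‖c‖ / 2 < ‖F x‖ :=
    h.norm.eventually_const_lt (by have := norm_pos_iff.2 hc; linarith)
  obtain ⟨B, hB⟩ := (hev.and (eventually_gt_atTop a)).exists_forall_of_atTop
  have hi : IntegrableOn (fun _ : ℝ => ‖c‖ / 2) (Ioi B) := by
    refine Integrable.mono' (hF.mono_set (Ioi_subset_Ioi (hB B le_rfl).2.le)).norm (by fun_prop) ?_
    refine (ae_restrict_iff' measurableSet_Ioi).2 (Eventually.of_forall fun x hx => ?_)
    rw [Real.norm_of_nonneg (by positivity)]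
    exact (hB x (le_of_lt hx)).1.le
  rw [integrableOn_const_iff (by simp)] at hi
  simp [hc] at hi

theorem integrableOn_tendsto_atBot_eq_zero {F : ℝ → ℂ} {a : ℝ} {c : ℂ}
    (hF : IntegrableOn F (Iio a)) (h : Tendsto F atBot (𝓝 c)) : c = 0 := by
  refine integrableOn_tendsto_atTop_eq_zero (F := fun x => F (-x)) (a := -a) ?_
    (h.comp tendsto_neg_atTop_atBot)
  exact IntegrableOn.comp_neg_Ioi (c := -a) (by simpa using hF)

/-- The fundamental theorem on [a, b] makes F(b) converge as b → ∞, and integrability of F forces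
the limit to be 0. -/
theorem integral_Ioi_of_absolutelyContinuous {F p : ℝ → ℂ} {a : ℝ}
    (hF : ∀ b, a ≤ b → AbsolutelyContinuousOnInterval F a b)
    (hFi : IntegrableOn F (Ioi a)) (hp : IntegrableOn p (Ioi a))
    (hd : ∀ᵐ x : ℝ, a < x → HasDerivAt F (p x) x) :
    ∫ x in Ioi a, p x = -F a := by
  have ht := intervalIntegral_tendsto_integral_Ioi a hp tendsto_id
  have he : ∀ᶠ b in atTop, ∫ x in a..id b, p x = F b - F a := by
    filter_upwards [eventually_ge_atTop a] with b hb
    refine integral_eq_sub_of_absolutelyContinuous hb (hF b hb) ?_ ?_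
    · exact (intervalIntegrable_iff_integrableOn_Ioc_of_le hb).2 (hp.mono_set Ioc_subset_Ioi_self)
    · filter_upwards [hd] with x hx hm using hx hm.1
  have ht' : Tendsto F atTop (𝓝 ((∫ x in Ioi a, p x) + F a)) :=
    ((ht.congr' he).add_const (F a)).congr fun x => by ring
  exact eq_neg_of_add_eq_zero_left (integrableOn_tendsto_atTop_eq_zero hFi ht')

theorem integral_Iio_of_absolutelyContinuous {F p : ℝ → ℂ} {b : ℝ}
    (hF : ∀ a, a ≤ b → AbsolutelyContinuousOnInterval F a b)
    (hFi : IntegrableOn F (Iio b)) (hp : IntegrableOn p (Iio b))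
    (hd : ∀ᵐ x : ℝ, x < b → HasDerivAt F (p x) x) :
    ∫ x in Iio b, p x = F b := by
  have hp' : IntegrableOn p (Iic b) := (integrableOn_Iic_iff_integrableOn_Iio).2 hp
  have ht := intervalIntegral_tendsto_integral_Iic b hp' tendsto_id
  have he : ∀ᶠ a in atBot, ∫ x in id a..b, p x = F b - F a := by
    filter_upwards [eventually_le_atBot b] with a ha
    refine integral_eq_sub_of_absolutelyContinuous ha (hF a ha) ?_ ?_
    · exact (intervalIntegrable_iff_integrableOn_Ioc_of_le ha).2 (hp'.mono_set Ioc_subset_Iic_self)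
    · filter_upwards [hd] with x hx hm using hx hm.2
  have ht' : Tendsto F atBot (𝓝 (F b - (∫ x in Iic b, p x))) :=
    ((ht.congr' he).const_sub (F b)).congr fun x => by ring
  rw [← integral_Iic_eq_integral_Iio]
  exact (sub_eq_zero.1 (integrableOn_tendsto_atBot_eq_zero hFi ht')).symm

/-! ### Functions whose weak derivative vanishes -/

/-- The primitive starting to the left of the support vanishes before the support, and also after it
because the total integral is 0. Order-connectedness keeps the interval between the extreme points
of the support inside S. -/
theorem exists_compactSupport_antideriv {S : Set ℝ} (hS : S.OrdConnected) {φ : ℝ → ℝ}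
    (hφ : Continuous φ) (hc : HasCompactSupport φ) (hs : tsupport φ ⊆ S) (h0 : ∫ x, φ x = 0) :
    ∃ g : ℝ → ℝ, ContDiff ℝ 1 g ∧ HasCompactSupport g ∧ tsupport g ⊆ S ∧
      ∀ x, HasDerivAt g (φ x) x := by
  rcases (tsupport φ).eq_empty_or_nonempty with he | hne
  · rw [tsupport_eq_empty_iff] at he
    subst he
    exact ⟨0, contDiff_const, HasCompactSupport.zero, by simp [tsupport],
      fun x => hasDerivAt_const x (0 : ℝ)⟩
  have hK : IsCompact (tsupport φ) := hc
  set a := sInf (tsupport φ)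
  set b := sSup (tsupport φ)
  have ha : a ∈ S := hs (hK.sInf_mem hne)
  have hb : b ∈ S := hs (hK.sSup_mem hne)
  have hφ0 : ∀ x, φ x ≠ 0 → x ∈ Icc a b := fun x hx =>
    ⟨csInf_le hK.bddBelow (subset_tsupport _ hx), le_csSup hK.bddAbove (subset_tsupport _ hx)⟩
  -- The base point a - 1 rather than a puts the whole support, including a, into the half-open
  -- interval of integration when x > b.
  have hderiv : ∀ x, HasDerivAt (fun x => ∫ t in (a - 1)..x, φ t) (φ x) x := fun x =>
    intervalIntegral.integral_hasDerivAt_right (hφ.intervalIntegrable _ _)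
      (hφ.stronglyMeasurableAtFilter _ _) hφ.continuousAt
  have hz : ∀ x, x ∉ Icc a b → ∫ t in (a - 1)..x, φ t = 0 := by
    intro x hx
    rcases lt_or_ge x a with hxa | hxa
    · rw [intervalIntegral.integral_congr (g := fun _ => (0 : ℝ)), intervalIntegral.integral_zero]
      intro t ht
      by_contra hne
      have h1 := (hφ0 t hne).1
      have h2 := ht.2
      rcases le_sup_iff.1 h2 with h | h <;> linarith
    · have hxb : b < x := by
        by_contra h
        exact hx ⟨hxa, not_lt.1 h⟩
      rw [intervalIntegral.integral_eq_integral_of_support_subset, h0]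
      intro t ht
      have := hφ0 t ht
      exact ⟨by linarith [this.1], by linarith [this.2]⟩
  have hts : tsupport (fun x => ∫ t in (a - 1)..x, φ t) ⊆ Icc a b :=
    closure_minimal (fun x hx => by
      by_contra h
      exact hx (hz x h)) isClosed_Icc
  refine ⟨_, ?_, isCompact_Icc.of_isClosed_subset (isClosed_tsupport _) hts,
    hts.trans (hS.out ha hb), hderiv⟩
  rw [contDiff_one_iff_deriv]
  refine ⟨fun x => (hderiv x).differentiableAt, ?_⟩
  rwa [show deriv (fun x => ∫ t in (a - 1)..x, φ t) = φ from funext fun x => (hderiv x).deriv]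

theorem integrable_smul_of_locallyIntegrableOn {S : Set ℝ} {h : ℝ → ℂ}
    (hh : LocallyIntegrableOn h S) {φ : ℝ → ℝ} (hφ : Continuous φ) (hc : HasCompactSupport φ)
    (hs : tsupport φ ⊆ S) : Integrable fun x => φ x • h x := by
  have hK : IntegrableOn h (tsupport φ) := (hh.mono_set hs).integrableOn_isCompact hc
  have := hK.continuousOn_smul hφ.continuousOn hc
  refine (integrableOn_iff_integrable_of_support_subset ?_).1 this
  intro x hx
  by_contra hn
  exact hx (by simp [image_eq_zero_of_notMem_tsupport hn])

/-- The lemma of du Bois-Reymond. -/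
theorem ae_eq_const_of_integral_deriv_smul_eq_zero {S : Set ℝ} (hSo : IsOpen S)
    (hSc : S.OrdConnected) {h : ℝ → ℂ} (hh : LocallyIntegrableOn h S)
    (H : ∀ g g' : ℝ → ℝ, ContDiff ℝ 1 g → HasCompactSupport g → tsupport g ⊆ S →
      (∀ x, HasDerivAt g (g' x) x) → ∫ x, g' x • h x = 0) :
    ∃ c : ℂ, ∀ᵐ x : ℝ, x ∈ S → h x = c := by
  rcases S.eq_empty_or_nonempty with rfl | ⟨x₀, hx₀⟩
  · exact ⟨0, by simp⟩
  obtain ⟨ρ, hρs, hρc, hρd, hρr, hρ1⟩ :=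
    exists_contDiff_tsupport_subset (n := ⊤) (hSo.mem_nhds hx₀)
  have hρpos : 0 < ∫ x, ρ x :=
    hρd.continuous.integral_pos_of_hasCompactSupport_nonneg_nonzero hρc
      (fun x => (hρr ⟨x, rfl⟩).1) (x := x₀) (by simp [hρ1])
  set r := ∫ x, ρ x
  have hρi : Integrable ρ := hρd.continuous.integrable_of_hasCompactSupport hρc
  have hρh := integrable_smul_of_locallyIntegrableOn hh hρd.continuous hρc hρs
  set q := ∫ x, ρ x • h x
  refine ⟨r⁻¹ • q, ?_⟩
  have key := hSo.ae_eq_zero_of_integral_contDiff_smul_eq_zero (μ := volume)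
    (f := fun x => h x - r⁻¹ • q) (hh.sub (locallyIntegrableOn_const _)) ?_
  · filter_upwards [key] with x hx hxS using sub_eq_zero.1 (hx hxS)
  intro φ hφd hφc hφs
  have hφi : Integrable φ := hφd.continuous.integrable_of_hasCompactSupport hφc
  have hφh := integrable_smul_of_locallyIntegrableOn hh hφd.continuous hφc hφs
  set s := ∫ x, φ x
  -- This combination has integral 0, so it is the derivative of an admissible test function. The
  -- hypothesis `H` then gives r ∫ φh = s q, which says that φ is orthogonal to h - q/r.
  set χ : ℝ → ℝ := fun x => r * φ x - s * ρ x
  have hχc : Continuous χ :=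
    (continuous_const.mul hφd.continuous).sub (continuous_const.mul hρd.continuous)
  have hχt : tsupport χ ⊆ tsupport φ ∪ tsupport ρ := by
    refine closure_minimal (fun x hx => ?_) ((isClosed_tsupport _).union (isClosed_tsupport _))
    by_contra hn
    rw [mem_union, not_or] at hn
    exact hx (by simp [χ, image_eq_zero_of_notMem_tsupport hn.1,
      image_eq_zero_of_notMem_tsupport hn.2])
  have hχK : HasCompactSupport χ :=
    (IsCompact.union hφc hρc).of_isClosed_subset (isClosed_tsupport _) hχt
  have hχ0 : ∫ x, χ x = 0 := by
    rw [integral_sub (hφi.const_mul r) (hρi.const_mul s), integral_const_mul, integral_const_mul]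
    ring
  obtain ⟨g, hg1, hg2, hg3, hg4⟩ :=
    exists_compactSupport_antideriv hSc hχc hχK (hχt.trans (union_subset hφs hρs)) hχ0
  have h1 := H g χ hg1 hg2 hg3 hg4
  have h2 : ∫ x, χ x • h x = r • (∫ x, φ x • h x) - s • q := by
    simp only [χ, sub_smul, mul_smul]
    have e1 : Integrable fun x => r • φ x • h x := hφh.smul r
    have e2 : Integrable fun x => s • ρ x • h x := hρh.smul s
    rw [integral_sub e1 e2, integral_smul, integral_smul]
  rw [h1] at h2
  have e3 : Integrable fun x => φ x • (r⁻¹ • q) := hφi.smul_const _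
  simp only [smul_sub]
  rw [integral_sub hφh e3, integral_smul_const]
  have h3 : r • (∫ x, φ x • h x) = s • q := (sub_eq_zero.1 h2.symm)
  rw [sub_eq_zero, ← inv_smul_smul₀ hρpos.ne' (∫ x, φ x • h x), h3, smul_comm]

end RealAnalysis

/-! ### Integration by parts and weak solutions in `L²(Ω)` -/

section Sobolev

variable {L : ℝ≥0}

theorem measurableSet_Omega (L : ℝ≥0) : MeasurableSet (Omega L) :=
  measurableSet_Iio.union measurableSet_Ioi

theorem disjoint_halfLines (L : ℝ≥0) : Disjoint (Iio (-(L : ℝ))) (Ioi (L : ℝ)) := by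
  rw [Set.disjoint_left]
  intro x h1 h2
  have := L.coe_nonneg
  simp only [mem_Iio, mem_Ioi] at h1 h2
  linarith

theorem integral_Omega {h : ℝ → ℂ} (hh : IntegrableOn h (Omega L)) :
    ∫ x in Omega L, h x = (∫ x in Iio (-(L : ℝ)), h x) + ∫ x in Ioi (L : ℝ), h x :=
  setIntegral_union (disjoint_halfLines L) measurableSet_Ioi
    (hh.mono_set subset_union_left) (hh.mono_set subset_union_right)

/-- Product rule for conj F · G on each half-line; the contributions at infinity vanish. It yields
the action of the adjoint when one function has zero boundary values, and also the norms of the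
exponentials. -/
theorem HasACDeriv.inner_add_inner {f f' g g' : L2 L} {FL FR BL BR : ℝ → ℂ}
    (hf : HasACDeriv L f f' FL FR) (hg : HasACDeriv L g g' BL BR) :
    inner ℂ f' g + inner ℂ f g' =
      conj (FL (-(L : ℝ))) * BL (-(L : ℝ)) - conj (FR (L : ℝ)) * BR (L : ℝ) := by
  have hconj : ∀ {F : ℝ → ℂ} {a b : ℝ}, AbsolutelyContinuousOnInterval F a b →
      AbsolutelyContinuousOnInterval (fun x => conj (F x)) a b := fun hF =>
    AbsolutelyContinuousOnInterval.of_dist_le hF fun x y => by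
      rw [Complex.dist_conj_conj]
  have hd : ∀ {F G : ℝ → ℂ} {F' G' : ℂ} {x : ℝ}, HasDerivAt F F' x → HasDerivAt G G' x →
      HasDerivAt (fun x => conj (F x) • G x) (inner ℂ F' (G x) + inner ℂ (F x) G') x := by
    intro F G F' G' x h1 h2
    have h3 : HasDerivAt (fun x => conj (F x)) (conj F') x :=
      Complex.conjCLE.toContinuousLinearMap.hasFDerivAt.comp_hasDerivAt x h1
    refine (h3.smul h2).congr_deriv ?_
    simp only [RCLike.inner_apply, smul_eq_mul]
    ring
  have i0 : IntegrableOn (fun x => inner ℂ (f x) (g x)) (Omega L) := L2.integrable_inner f g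
  have i1 : IntegrableOn (fun x => inner ℂ (f' x) (g x)) (Omega L) := L2.integrable_inner f' g
  have i2 : IntegrableOn (fun x => inner ℂ (f x) (g' x)) (Omega L) := L2.integrable_inner f g'
  have i3 : IntegrableOn (fun x => inner ℂ (f' x) (g x) + inner ℂ (f x) (g' x)) (Omega L) :=
    i1.add i2
  rw [L2.inner_def, L2.inner_def, ← integral_add i1 i2, integral_Omega i3]
  have eL := integral_Iio_of_absolutelyContinuous (b := -(L : ℝ))
    (F := fun x => conj (FL x) • BL x)
    (p := fun x => inner ℂ (f' x) (g x) + inner ℂ (f x) (g' x))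
    (fun a ha => (hconj (hf.ac_left a ha)).smul (hg.ac_left a ha))
    ((i0.mono_set subset_union_left).congr ((ae_restrict_iff' measurableSet_Iio).2 (by
      filter_upwards [hf.eq_left, hg.eq_left] with x h1 h2 hx
      rw [h1 hx, h2 hx, RCLike.inner_apply, smul_eq_mul, mul_comm])))
    (i3.mono_set subset_union_left) (by
      filter_upwards [hf.eq_left, hg.eq_left, hf.deriv_left, hg.deriv_left] with x h1 h2 h3 h4 hx
      rw [h1 hx, h2 hx]
      exact hd (h3 hx) (h4 hx))
  have eR := integral_Ioi_of_absolutelyContinuous (a := (L : ℝ))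
    (F := fun x => conj (FR x) • BR x)
    (p := fun x => inner ℂ (f' x) (g x) + inner ℂ (f x) (g' x))
    (fun a ha => (hconj (hf.ac_right a ha)).smul (hg.ac_right a ha))
    ((i0.mono_set subset_union_right).congr ((ae_restrict_iff' measurableSet_Ioi).2 (by
      filter_upwards [hf.eq_right, hg.eq_right] with x h1 h2 hx
      rw [h1 hx, h2 hx, RCLike.inner_apply, smul_eq_mul, mul_comm])))
    (i3.mono_set subset_union_right) (by
      filter_upwards [hf.eq_right, hg.eq_right, hf.deriv_right, hg.deriv_right] with x h1 h2 h3 h4 hx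
      rw [h1 hx, h2 hx]
      exact hd (h3 hx) (h4 hx))
  rw [eL, eR, smul_eq_mul, smul_eq_mul, sub_eq_add_neg]

theorem HasACDeriv.toLp_of_contDiff {F F' : ℝ → ℂ} (hF : ContDiff ℝ 1 F)
    (hd : ∀ x, HasDerivAt F (F' x) x) (h : MemLp F 2 (volume.restrict (Omega L)))
    (h' : MemLp F' 2 (volume.restrict (Omega L))) :
    HasACDeriv L (h.toLp F) (h'.toLp F') F F := by
  have e := ae_of_ae_restrict h.coeFn_toLp
  have e' := ae_of_ae_restrict h'.coeFn_toLp
  refine ⟨fun a _ => hF.contDiffOn.absolutelyContinuousOnInterval,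
    fun b _ => hF.contDiffOn.absolutelyContinuousOnInterval, ?_, ?_, ?_, ?_⟩
  · filter_upwards [e] with x hx hm using hx (Or.inl hm)
  · filter_upwards [e] with x hx hm using hx (Or.inr hm)
  · filter_upwards [e'] with x hx hm
    rw [hx (Or.inl hm)]
    exact hd x
  · filter_upwards [e'] with x hx hm
    rw [hx (Or.inr hm)]
    exact hd x

theorem locallyIntegrableOn_L2 (s : L2 L) : LocallyIntegrableOn s (Omega L) :=
  locallyIntegrableOn_of_locallyIntegrable_restrict
    ((Lp.memLp s).locallyIntegrable (by norm_num))

theorem inner_toLp_real {F : ℝ → ℝ} (hs : tsupport F ⊆ Omega L)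
    (h : MemLp (fun x => (F x : ℂ)) 2 (volume.restrict (Omega L))) (s : L2 L) :
    inner ℂ (h.toLp _) s = ∫ x, F x • s x := by
  rw [L2.inner_def, ← setIntegral_eq_integral_of_forall_compl_eq_zero (s := Omega L)
    (f := fun x => F x • s x)]
  · refine integral_congr_ae ?_
    filter_upwards [h.coeFn_toLp] with x hx
    rw [hx, RCLike.inner_apply, Complex.conj_ofReal, Complex.real_smul, mul_comm]
  · intro x hx
    rw [image_eq_zero_of_notMem_tsupport (fun h => hx (hs h)), zero_smul]

theorem memLp_ofReal_of_hasCompactSupport {F : ℝ → ℝ} (hF : Continuous F)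
    (hc : HasCompactSupport F) : MemLp (fun x => (F x : ℂ)) 2 (volume.restrict (Omega L)) :=
  (Complex.continuous_ofReal.comp hF).memLp_of_hasCompactSupport
    (hc.comp_left (g := fun x : ℝ => (x : ℂ)) Complex.ofReal_zero)

theorem notMem_Omega_left (L : ℝ≥0) : -(L : ℝ) ∉ Omega L := by
  have := L.coe_nonneg
  rintro (h | h) <;> simp only [mem_Iio, mem_Ioi] at h <;> linarith

theorem notMem_Omega_right (L : ℝ≥0) : (L : ℝ) ∉ Omega L := by
  have := L.coe_nonneg
  rintro (h | h) <;> simp only [mem_Iio, mem_Ioi] at h <;> linarith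

theorem HasACDeriv.toLp_real {F F' : ℝ → ℝ} (hF : ContDiff ℝ 1 F)
    (hd : ∀ x, HasDerivAt F (F' x) x)
    (h : MemLp (fun x => (F x : ℂ)) 2 (volume.restrict (Omega L)))
    (h' : MemLp (fun x => (F' x : ℂ)) 2 (volume.restrict (Omega L))) :
    HasACDeriv L (h.toLp _) (h'.toLp _) (fun x => (F x : ℂ)) (fun x => (F x : ℂ)) :=
  HasACDeriv.toLp_of_contDiff (Complex.ofRealCLM.contDiff.comp hF)
    (fun x => (hd x).ofReal_comp) h h'

/-- `AC¹₀` is dense in `L²(Ω)`. -/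
theorem eq_zero_of_inner_AC0 {s : L2 L} (h : ∀ f ∈ AC0 L, inner ℂ f s = 0) : s = 0 := by
  have hz := (isOpen_Iio.union isOpen_Ioi).ae_eq_zero_of_integral_contDiff_smul_eq_zero
    (μ := volume) (locallyIntegrableOn_L2 s) (fun g hg hc hs => ?_)
  · refine Lp.ext ((ae_restrict_iff' (measurableSet_Omega L)).2 ?_)
    filter_upwards [hz, ae_of_ae_restrict (Lp.coeFn_zero ℂ 2 (volume.restrict (Omega L)))]
      with x h1 h2 hx
    rw [h1 hx, h2 hx]; rfl
  · have h1 : ContDiff ℝ 1 g := hg.of_le (by exact_mod_cast le_top)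
    have m := memLp_ofReal_of_hasCompactSupport (L := L) h1.continuous hc
    have m' := memLp_ofReal_of_hasCompactSupport (L := L) (h1.continuous_deriv le_rfl) hc.deriv
    rw [← inner_toLp_real hs m]
    -- A test function supported in Ω vanishes at ±Λ, since these points are not in Ω.
    refine h _ ⟨_, _, _, HasACDeriv.toLp_real h1
      (fun x => (h1.differentiable one_ne_zero x).hasDerivAt) m m', ?_, ?_⟩
    · rw [image_eq_zero_of_notMem_tsupport fun h => notMem_Omega_left L (hs h), ofReal_zero]
    · rw [image_eq_zero_of_notMem_tsupport fun h => notMem_Omega_right L (hs h), ofReal_zero]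

/-- A weak solution of `s' = -k s` on an interval in `Ω` is a multiple of `e^{-kx}` there. -/
theorem exists_ae_eq_exp_of_weak {s : L2 L} {k : ℝ}
    (h : ∀ f f' FL FR, HasACDeriv L f f' FL FR → FL (-(L : ℝ)) = 0 → FR (L : ℝ) = 0 →
      inner ℂ f' s = k * inner ℂ f s)
    {S : Set ℝ} (hSo : IsOpen S) (hSc : S.OrdConnected) (hS : S ⊆ Omega L) :
    ∃ c : ℂ, ∀ᵐ x : ℝ, x ∈ S → s x = c * (Real.exp (-k * x) : ℂ) := by
  have hl : LocallyIntegrableOn (fun x => Real.exp (k * x) • s x) S :=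
    ((locallyIntegrableOn_L2 s).mono_set hS).continuousOn_smul hSo.isLocallyClosed (by fun_prop)
  have hex := ae_eq_const_of_integral_deriv_smul_eq_zero hSo hSc hl
    (fun g g' hg hgc hgs hd => ?_)
  · obtain ⟨c, hc⟩ := hex
    refine ⟨c, ?_⟩
    filter_upwards [hc] with x hx hm
    rw [← hx hm, Complex.real_smul, mul_right_comm, ← Complex.ofReal_mul, ← Real.exp_add]
    simp
  · have hg' : g' = deriv g := funext fun x => (hd x).deriv.symm
    -- Testing the weak equation with e^{kx} g, where F' - kF = e^{kx} g', shows that e^{kx} s has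
    -- weak derivative 0.
    set F : ℝ → ℝ := fun x => Real.exp (k * x) * g x
    set F' : ℝ → ℝ := fun x => k * F x + Real.exp (k * x) * g' x
    have hF : ContDiff ℝ 1 F := by fun_prop
    have hFd : ∀ x, HasDerivAt F (F' x) x := fun x => by
      have h1 : HasDerivAt (fun x => Real.exp (k * x)) (Real.exp (k * x) * (k * 1)) x :=
        ((hasDerivAt_id x).const_mul k).exp
      refine (h1.mul (hd x)).congr_deriv ?_
      simp only [F', F]
      ring
    have hFc : HasCompactSupport F := hgc.mul_left
    have hF'c : Continuous F' := by
      have := hg.continuous_deriv le_rfl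
      rw [← hg'] at this
      have := hF.continuous
      fun_prop
    have hFF : F' = deriv F := funext fun x => (hFd x).deriv.symm
    have hF'K : HasCompactSupport F' := hFF ▸ hFc.deriv
    have hFs : tsupport F ⊆ S := (tsupport_mul_subset_right).trans hgs
    have hF's : tsupport F' ⊆ S := by
      rw [hFF]
      exact (tsupport_deriv_subset).trans hFs
    have m := memLp_ofReal_of_hasCompactSupport (L := L) hF.continuous hFc
    have m' := memLp_ofReal_of_hasCompactSupport (L := L) hF'c hF'K
    have key := h _ _ _ _ (HasACDeriv.toLp_real hF hFd m m')
      (by rw [image_eq_zero_of_notMem_tsupport fun h => notMem_Omega_left L (hS (hFs h)),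
        ofReal_zero])
      (by rw [image_eq_zero_of_notMem_tsupport fun h => notMem_Omega_right L (hS (hFs h)),
        ofReal_zero])
    rw [inner_toLp_real (hF's.trans hS), inner_toLp_real (hFs.trans hS)] at key
    have i1 := integrable_smul_of_locallyIntegrableOn (locallyIntegrableOn_L2 s) hF.continuous hFc
      (hFs.trans hS)
    have i2 := integrable_smul_of_locallyIntegrableOn (locallyIntegrableOn_L2 s) hF'c hF'K
      (hF's.trans hS)
    have : ∀ x, g' x • Real.exp (k * x) • s x = F' x • s x - (k : ℂ) * (F x • s x) := fun x => by
      simp only [F', Complex.real_smul]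
      push_cast
      ring
    simp only [this]
    rw [integral_sub i2 (i1.const_mul _), integral_const_mul, key, sub_self]

theorem norm_sq_le_norm_inner_mul_exp (c : ℂ) {t : ℝ} (ht : 0 ≤ t) :
    ‖(‖c‖ ^ 2 : ℝ)‖ ≤ ‖inner ℂ (c * (Real.exp t : ℂ)) (c * (Real.exp t : ℂ))‖ := by
  have h : ‖c‖ ≤ ‖c‖ * Real.exp t :=
    le_mul_of_one_le_right (norm_nonneg _) (Real.one_le_exp ht)
  rw [inner_self_eq_norm_sq_to_K, norm_pow, norm_pow, RCLike.norm_ofReal, abs_norm, norm_norm,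
    norm_mul, Complex.norm_real, Real.norm_eq_abs, Real.abs_exp]
  gcongr

/-- A function in `L²(Ω)` is not a nontrivial multiple of a growing exponential. -/
theorem eq_zero_of_ae_eq_exp_right {s : L2 L} {k : ℝ} (hk : 0 ≤ k) {c : ℂ}
    (h : ∀ᵐ x : ℝ, x ∈ Ioi (L : ℝ) → s x = c * (Real.exp (k * x) : ℂ)) : c = 0 := by
  have hi : IntegrableOn (fun x => inner ℂ (s x) (s x)) (Omega L) := L2.integrable_inner s s
  -- On this half-line |s|² is at least the constant |c|², which is integrable over a set of
  -- infinite measure only if it is 0.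
  have hi' : IntegrableOn (fun _ : ℝ => ‖c‖ ^ 2) (Ioi (L : ℝ)) := by
    refine Integrable.mono' (hi.mono_set subset_union_right).norm (by fun_prop) ?_
    refine (ae_restrict_iff' measurableSet_Ioi).2 ?_
    filter_upwards [h] with x hx hm
    have h0 : (0 : ℝ) ≤ x := L.coe_nonneg.trans (le_of_lt hm)
    have h1 : 0 ≤ k * x := by positivity
    rw [hx hm]
    exact norm_sq_le_norm_inner_mul_exp c h1
  rw [integrableOn_const_iff (by simp)] at hi'
  simpa using hi'

theorem eq_zero_of_ae_eq_exp_left {s : L2 L} {k : ℝ} (hk : 0 ≤ k) {c : ℂ}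
    (h : ∀ᵐ x : ℝ, x ∈ Iio (-(L : ℝ)) → s x = c * (Real.exp (-k * x) : ℂ)) : c = 0 := by
  have hi : IntegrableOn (fun x => inner ℂ (s x) (s x)) (Omega L) := L2.integrable_inner s s
  have hi' : IntegrableOn (fun _ : ℝ => ‖c‖ ^ 2) (Iio (-(L : ℝ))) := by
    refine Integrable.mono' (hi.mono_set subset_union_left).norm (by fun_prop) ?_
    refine (ae_restrict_iff' measurableSet_Iio).2 ?_
    filter_upwards [h] with x hx hm
    have h0 : x ≤ 0 := by
      have := L.coe_nonneg
      have := mem_Iio.1 hm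
      linarith
    have h1 : 0 ≤ -k * x := by nlinarith
    rw [hx hm]
    exact norm_sq_le_norm_inner_mul_exp c h1
  rw [integrableOn_const_iff (by simp)] at hi'
  simpa using hi'

end Sobolev

/-! ### The adjoint of the minimal Dirac operator -/

section Adjoint

theorem mem_adjointEigenspace {H : Type*} [NormedAddCommGroup H] [InnerProductSpace ℂ H]
    [CompleteSpace H] {A : H →ₗ.[ℂ] H} {z : ℂ} {ψ : H} :
    ψ ∈ adjointEigenspace A z ↔
      ∃ h : ψ ∈ A.adjoint.domain, A.adjoint ⟨ψ, h⟩ = z • ψ := by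
  constructor
  · rintro ⟨φ, hφ, rfl⟩
    exact ⟨φ.2, (sub_eq_zero.1 (LinearMap.mem_ker.1 hφ)).symm⟩
  · rintro ⟨h, e⟩
    exact ⟨⟨ψ, h⟩, LinearMap.mem_ker.2 (sub_eq_zero.2 e.symm), rfl⟩

variable {m : ℝ} {L : ℝ≥0}

theorem momentum_apply {f g : L2 L} {FL FR : ℝ → ℂ} (h : HasACDeriv L f g FL FR)
    (hf : f ∈ AC0 L) : momentum L ⟨f, hf⟩ = -I • g := by
  change -I • ddx L (Submodule.inclusion (AC0_le_AC L) ⟨f, hf⟩) = -I • g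
  obtain ⟨_, _, h'⟩ := (Submodule.inclusion (AC0_le_AC L) ⟨f, hf⟩).2.choose_spec
  exact congrArg _ (h'.unique h)

theorem minimalDirac_apply {φ : WaveSpace L} (hφ : φ ∈ minimalDomain L) {gu gd : L2 L}
    {UL UR DL DR : ℝ → ℂ} (hu : HasACDeriv L φ.fst gu UL UR) (hd : HasACDeriv L φ.snd gd DL DR) :
    minimalDirac m L ⟨φ, hφ⟩ =
      WithLp.toLp 2 (-I • gd + (m : ℂ) • φ.fst, -I • gu - (m : ℂ) • φ.snd) := by
  change WithLp.toLp 2 (momentum L ⟨φ.snd, hφ.2⟩ + (m : ℂ) • φ.fst,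
    momentum L ⟨φ.fst, hφ.1⟩ - (m : ℂ) • φ.snd) = _
  rw [momentum_apply hu, momentum_apply hd]

theorem inner_waveSpace (a b c d : L2 L) :
    inner ℂ (WithLp.toLp 2 (a, b) : WaveSpace L) (WithLp.toLp 2 (c, d)) =
      inner ℂ a c + inner ℂ b d := WithLp.prod_inner_apply _ _

theorem dense_minimalDomain (m : ℝ) (L : ℝ≥0) :
    Dense ((minimalDirac m L).domain : Set (WaveSpace L)) := by
  rw [Submodule.dense_iff_topologicalClosure_eq_top, Submodule.topologicalClosure_eq_top_iff,
    Submodule.eq_bot_iff]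
  intro ψ hψ
  have h1 : ψ.fst = 0 := eq_zero_of_inner_AC0 fun f hf => by
    have := (Submodule.mem_orthogonal _ _).1 hψ (WithLp.toLp 2 (f, 0)) ⟨hf, (AC0 L).zero_mem⟩
    simpa [WithLp.prod_inner_apply] using this
  have h2 : ψ.snd = 0 := eq_zero_of_inner_AC0 fun f hf => by
    have := (Submodule.mem_orthogonal _ _).1 hψ (WithLp.toLp 2 (0, f)) ⟨(AC0 L).zero_mem, hf⟩
    simpa [WithLp.prod_inner_apply] using this
  apply (WithLp.equiv 2 _).injective
  exact Prod.ext h1 h2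

/-- The adjoint of the minimal Dirac operator acts on absolutely continuous wave functions as the
Dirac operator. -/
theorem maximalDirac_apply (m : ℝ) {ψ : WaveSpace L} {gu gd : L2 L} {UL UR DL DR : ℝ → ℂ}
    (hu : HasACDeriv L ψ.fst gu UL UR) (hd : HasACDeriv L ψ.snd gd DL DR) :
    ∃ h : ψ ∈ (maximalDirac m L).domain, maximalDirac m L ⟨ψ, h⟩ =
      WithLp.toLp 2 (-I • gd + (m : ℂ) • ψ.fst, -I • gu - (m : ℂ) • ψ.snd) := by
  -- Integration by parts against φ leaves no boundary terms, because those of φ vanish; the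
  -- boundary values of ψ are arbitrary.
  have key : ∀ φ : (minimalDirac m L).domain,
      inner ℂ (WithLp.toLp 2 (-I • gd + (m : ℂ) • ψ.fst, -I • gu - (m : ℂ) • ψ.snd) : WaveSpace L)
        (φ : WaveSpace L) = inner ℂ ψ (minimalDirac m L φ) := by
    rintro ⟨φ, hφ⟩
    obtain ⟨fu, FL, FR, hf, hf1, hf2⟩ := hφ.1
    obtain ⟨fd, EL, ER, he, he1, he2⟩ := hφ.2
    rw [minimalDirac_apply hφ hf he, WithLp.prod_inner_apply, WithLp.prod_inner_apply]
    have e1 := hd.inner_add_inner hf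
    have e2 := hu.inner_add_inner he
    rw [hf1, hf2] at e1
    rw [he1, he2] at e2
    simp only [mul_zero, sub_zero] at e1 e2
    change inner ℂ (-I • gd + (m : ℂ) • ψ.fst) φ.fst + inner ℂ (-I • gu - (m : ℂ) • ψ.snd) φ.snd
      = inner ℂ ψ.fst (-I • fd + (m : ℂ) • φ.fst) + inner ℂ ψ.snd (-I • fu - (m : ℂ) • φ.snd)
    simp only [inner_add_left, inner_sub_left, inner_add_right, inner_sub_right, inner_smul_left,
      inner_smul_right, map_neg, Complex.conj_I, Complex.conj_ofReal, neg_neg]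
    linear_combination I * e1 + I * e2
  have h := LinearPMap.mem_adjoint_domain_of_exists ψ ⟨_, key⟩
  exact ⟨h, LinearPMap.adjoint_apply_eq (dense_minimalDomain m L) ⟨ψ, h⟩ key⟩

/-! ### The deficiency subspaces -/

theorem hasACDeriv_leftExp (m : ℝ) (L : ℝ≥0) :
    HasACDeriv L ((memLp_leftExp m L).toLp _) ((kappa m : ℂ) • (memLp_leftExp m L).toLp _)
      (fun x => (Real.exp (kappa m * x) : ℂ)) 0 := by
  have e := ae_of_ae_restrict (memLp_leftExp m L).coeFn_toLp
  have e' := ae_of_ae_restrict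
    (Lp.coeFn_smul (kappa m : ℂ) ((memLp_leftExp m L).toLp (leftExp m L)))
  have hL := L.coe_nonneg
  have v1 : ∀ x : ℝ, x < -(L : ℝ) → leftExp m L x = (Real.exp (kappa m * x) : ℂ) := fun x hx =>
    indicator_of_mem (show x ∈ Iic (-(L : ℝ)) from hx.le) _
  have v2 : ∀ x : ℝ, (L : ℝ) < x → leftExp m L x = 0 := fun x hx =>
    indicator_of_notMem (fun h => by have := mem_Iic.1 h; linarith) _
  have hc : ContDiff ℝ 1 fun x : ℝ => (Real.exp (kappa m * x) : ℂ) :=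
    Complex.ofRealCLM.contDiff.comp (Real.contDiff_exp.comp (contDiff_const.mul contDiff_id))
  refine ⟨fun a _ => hc.contDiffOn.absolutelyContinuousOnInterval,
    fun b _ => (contDiff_const (c := (0 : ℂ))).contDiffOn.absolutelyContinuousOnInterval,
    ?_, ?_, ?_, ?_⟩
  · filter_upwards [e] with x hx hm
    rw [hx (Or.inl hm), v1 x hm]
  · filter_upwards [e] with x hx hm
    rw [hx (Or.inr hm), v2 x hm, Pi.zero_apply]
  · filter_upwards [e, e'] with x hx hx' hm
    rw [hx' (Or.inl hm), Pi.smul_apply, hx (Or.inl hm), v1 x hm, smul_eq_mul]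
    have h1 : HasDerivAt (fun x => Real.exp (kappa m * x))
        (Real.exp (kappa m * x) * (kappa m * 1)) x := ((hasDerivAt_id x).const_mul _).exp
    refine h1.ofReal_comp.congr_deriv ?_
    push_cast
    ring
  · filter_upwards [e, e'] with x hx hx' hm
    rw [hx' (Or.inr hm), Pi.smul_apply, hx (Or.inr hm), v2 x hm, smul_zero]
    exact hasDerivAt_const x (0 : ℂ)

theorem hasACDeriv_rightExp (m : ℝ) (L : ℝ≥0) :
    HasACDeriv L ((memLp_rightExp m L).toLp _) ((-kappa m : ℂ) • (memLp_rightExp m L).toLp _)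
      0 (fun x => (Real.exp (-kappa m * x) : ℂ)) := by
  have e := ae_of_ae_restrict (memLp_rightExp m L).coeFn_toLp
  have e' := ae_of_ae_restrict
    (Lp.coeFn_smul (-kappa m : ℂ) ((memLp_rightExp m L).toLp (rightExp m L)))
  have hL := L.coe_nonneg
  have v1 : ∀ x : ℝ, (L : ℝ) < x → rightExp m L x = (Real.exp (-kappa m * x) : ℂ) := fun x hx =>
    indicator_of_mem (show x ∈ Ici (L : ℝ) from hx.le) _
  have v2 : ∀ x : ℝ, x < -(L : ℝ) → rightExp m L x = 0 := fun x hx =>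
    indicator_of_notMem (fun h => by have := mem_Ici.1 h; linarith) _
  have hc : ContDiff ℝ 1 fun x : ℝ => (Real.exp (-kappa m * x) : ℂ) :=
    Complex.ofRealCLM.contDiff.comp (Real.contDiff_exp.comp (contDiff_const.mul contDiff_id))
  refine ⟨fun a _ => (contDiff_const (c := (0 : ℂ))).contDiffOn.absolutelyContinuousOnInterval,
    fun b _ => hc.contDiffOn.absolutelyContinuousOnInterval, ?_, ?_, ?_, ?_⟩
  · filter_upwards [e] with x hx hm
    rw [hx (Or.inl hm), v2 x hm, Pi.zero_apply]
  · filter_upwards [e] with x hx hm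
    rw [hx (Or.inr hm), v1 x hm]
  · filter_upwards [e, e'] with x hx hx' hm
    rw [hx' (Or.inl hm), Pi.smul_apply, hx (Or.inl hm), v2 x hm, smul_zero]
    exact hasDerivAt_const x (0 : ℂ)
  · filter_upwards [e, e'] with x hx hx' hm
    rw [hx' (Or.inr hm), Pi.smul_apply, hx (Or.inr hm), v1 x hm, smul_eq_mul]
    have h1 : HasDerivAt (fun x => Real.exp (-kappa m * x))
        (Real.exp (-kappa m * x) * (-kappa m * 1)) x := ((hasDerivAt_id x).const_mul _).exp
    refine h1.ofReal_comp.congr_deriv ?_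
    push_cast
    ring

/-- The two equations for ν say that (1, -ν)e^{κx} solves the Dirac equation with eigenvalue z.
Taking z = i, ν = μ or z = -i, ν = -μ* treats both deficiency subspaces at once. -/
theorem leftState_mem {z ν : ℂ} (hν : ν * conj ν = 1) (h1 : kappa m * ν = -I * (z - m))
    (h2 : kappa m * conj ν = -I * (z + m)) :
    leftState m L (-ν) ∈ adjointEigenspace (minimalDirac m L) z := by
  have he := hasACDeriv_leftExp m L
  rw [mem_adjointEigenspace]
  obtain ⟨h, e⟩ := maximalDirac_apply m (ψ := leftState m L (-ν))
    (he.smul (normConst m L : ℂ)) ((he.smul (-ν)).smul (normConst m L : ℂ))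
  refine ⟨h, e.trans ?_⟩
  set E := (memLp_leftExp m L).toLp (leftExp m L)
  set n : ℂ := ((normConst m L : ℝ) : ℂ)
  change WithLp.toLp 2 (-I • n • (-ν) • (kappa m : ℂ) • E + (m : ℂ) • n • E,
    -I • n • (kappa m : ℂ) • E - (m : ℂ) • n • (-ν) • E) = WithLp.toLp 2 (z • n • E, z • n • (-ν) • E)
  have hI := Complex.I_mul_I
  congr 2
  · match_scalars
    linear_combination I * n * h1 - n * (z - m) * hI
  · match_scalars
    linear_combination -I * n * ν * h2 + n * ν * (z + m) * hI + I * n * kappa m * hν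

theorem rightState_mem {z ν : ℂ} (hν : ν * conj ν = 1) (h1 : kappa m * ν = -I * (z - m))
    (h2 : kappa m * conj ν = -I * (z + m)) :
    rightState m L ν ∈ adjointEigenspace (minimalDirac m L) z := by
  have he := hasACDeriv_rightExp m L
  rw [mem_adjointEigenspace]
  obtain ⟨h, e⟩ := maximalDirac_apply m (ψ := rightState m L ν)
    (he.smul (normConst m L : ℂ)) ((he.smul ν).smul (normConst m L : ℂ))
  refine ⟨h, e.trans ?_⟩
  set E := (memLp_rightExp m L).toLp (rightExp m L)
  set n : ℂ := ((normConst m L : ℝ) : ℂ)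
  change WithLp.toLp 2 (-I • n • ν • (-kappa m : ℂ) • E + (m : ℂ) • n • E,
    -I • n • (-kappa m : ℂ) • E - (m : ℂ) • n • ν • E) = WithLp.toLp 2 (z • n • E, z • n • ν • E)
  have hI := Complex.I_mul_I
  congr 2
  · match_scalars
    linear_combination I * n * h1 - n * (z - m) * hI
  · match_scalars
    linear_combination I * n * ν * h2 - n * ν * (z + m) * hI - I * n * kappa m * hν

theorem normConst_pos (m : ℝ) (L : ℝ≥0) : 0 < normConst m L := by
  unfold normConst
  positivity

theorem eq_smul_leftExp {t : L2 L} {c : ℂ}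
    (h1 : ∀ᵐ x : ℝ, x ∈ Iio (-(L : ℝ)) → t x = c * (Real.exp (kappa m * x) : ℂ))
    (h2 : ∀ᵐ x : ℝ, x ∈ Ioi (L : ℝ) → t x = 0) :
    t = c • (memLp_leftExp m L).toLp (leftExp m L) := by
  have e := hasACDeriv_leftExp m L
  have e' := ae_of_ae_restrict (Lp.coeFn_smul c ((memLp_leftExp m L).toLp (leftExp m L)))
  refine Lp.ext ((ae_restrict_iff' (measurableSet_Omega L)).2 ?_)
  filter_upwards [h1, h2, e', e.eq_left, e.eq_right] with x h1 h2 h3 h4 h5 hx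
  rw [h3 hx, Pi.smul_apply]
  rcases hx with hx | hx
  · rw [h1 hx, h4 hx, smul_eq_mul]
  · rw [h2 hx, h5 hx, Pi.zero_apply, smul_zero]

theorem eq_smul_rightExp {t : L2 L} {c : ℂ}
    (h1 : ∀ᵐ x : ℝ, x ∈ Iio (-(L : ℝ)) → t x = 0)
    (h2 : ∀ᵐ x : ℝ, x ∈ Ioi (L : ℝ) → t x = c * (Real.exp (-kappa m * x) : ℂ)) :
    t = c • (memLp_rightExp m L).toLp (rightExp m L) := by
  have e := hasACDeriv_rightExp m L
  have e' := ae_of_ae_restrict (Lp.coeFn_smul c ((memLp_rightExp m L).toLp (rightExp m L)))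
  refine Lp.ext ((ae_restrict_iff' (measurableSet_Omega L)).2 ?_)
  filter_upwards [h1, h2, e', e.eq_left, e.eq_right] with x h1 h2 h3 h4 h5 hx
  rw [h3 hx, Pi.smul_apply]
  rcases hx with hx | hx
  · rw [h1 hx, h4 hx, Pi.zero_apply, smul_zero]
  · rw [h2 hx, h5 hx, smul_eq_mul]

/-- The eigenspace of the maximal Dirac operator is spanned by the two exponential states. -/
theorem exists_eq_of_mem_adjointEigenspace {z ν : ℂ} (hν : ν * conj ν = 1)
    (h1 : kappa m * ν = -I * (z - m)) (h2 : kappa m * conj ν = -I * (z + m)) {ψ : WaveSpace L}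
    (hψ : ψ ∈ adjointEigenspace (minimalDirac m L) z) :
    ∃ a b : ℂ, ψ = a • leftState m L (-ν) + b • rightState m L ν := by
  obtain ⟨h, e⟩ := mem_adjointEigenspace.1 hψ
  have hadj := LinearPMap.adjoint_isFormalAdjoint (dense_minimalDomain m L) ⟨ψ, h⟩
  rw [e] at hadj
  have hI := Complex.I_mul_I
  set u := ψ.fst
  set d := ψ.snd
  -- Pairing the eigenvalue equation with (f, 0) and (0, f) gives a coupled first-order system for
  -- the two spin components, in weak form.
  have weak : ∀ f f' FL FR, HasACDeriv L f f' FL FR → FL (-(L : ℝ)) = 0 → FR (L : ℝ) = 0 →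
      inner ℂ f' d = kappa m * ν * inner ℂ f u ∧
      inner ℂ f' u = kappa m * conj ν * inner ℂ f d := by
    intro f f' FL FR hf b1 b2
    have hf0 : f ∈ AC0 L := ⟨_, _, _, hf, b1, b2⟩
    have m1 : (WithLp.toLp 2 (f, 0) : WaveSpace L) ∈ minimalDomain L := ⟨hf0, (AC0 L).zero_mem⟩
    have m2 : (WithLp.toLp 2 (0, f) : WaveSpace L) ∈ minimalDomain L := ⟨(AC0 L).zero_mem, hf0⟩
    have k1 := hadj ⟨_, m1⟩
    have k2 := hadj ⟨_, m2⟩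
    rw [minimalDirac_apply m1 hf HasACDeriv.zero, WithLp.prod_inner_apply,
      WithLp.prod_inner_apply] at k1
    rw [minimalDirac_apply m2 HasACDeriv.zero hf, WithLp.prod_inner_apply,
      WithLp.prod_inner_apply] at k2
    change inner ℂ (z • u) f + inner ℂ (z • d) 0 =
      inner ℂ u (-I • (0 : L2 L) + (m : ℂ) • f) + inner ℂ d (-I • f' - (m : ℂ) • (0 : L2 L)) at k1
    change inner ℂ (z • u) 0 + inner ℂ (z • d) f =
      inner ℂ u (-I • f' + (m : ℂ) • (0 : L2 L)) + inner ℂ d (-I • (0 : L2 L) - (m : ℂ) • f) at k2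
    have c1 := congrArg conj k1
    have c2 := congrArg conj k2
    simp only [smul_zero, inner_zero_right, zero_add, add_zero, sub_zero, zero_sub,
      inner_smul_left, inner_smul_right, inner_neg_right, map_add, map_mul, map_neg,
      Complex.conj_I, Complex.conj_ofReal, Complex.conj_conj, inner_conj_symm, neg_neg] at c1 c2
    constructor
    · linear_combination -inner ℂ f u * h1 + I * c1 + inner ℂ f' d * hI
    · linear_combination -inner ℂ f d * h2 + I * c2 + inner ℂ f' u * hI
  -- The combinations d ± νu decouple the system because νν* = 1; they solve s' = -κs and t' = κt
  -- weakly.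
  set s : L2 L := d + ν • u
  set t : L2 L := d - ν • u
  have ws : ∀ f f' FL FR, HasACDeriv L f f' FL FR → FL (-(L : ℝ)) = 0 → FR (L : ℝ) = 0 →
      inner ℂ f' s = kappa m * inner ℂ f s := by
    intro f f' FL FR hf b1 b2
    obtain ⟨w1, w2⟩ := weak f f' FL FR hf b1 b2
    simp only [s, inner_add_right, inner_smul_right, w1, w2]
    linear_combination kappa m * inner ℂ f d * hν
  have wt : ∀ f f' FL FR, HasACDeriv L f f' FL FR → FL (-(L : ℝ)) = 0 → FR (L : ℝ) = 0 →
      inner ℂ f' t = ((-kappa m : ℝ) : ℂ) * inner ℂ f t := by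
    intro f f' FL FR hf b1 b2
    obtain ⟨w1, w2⟩ := weak f f' FL FR hf b1 b2
    simp only [t, inner_sub_right, inner_smul_right, w1, w2]
    push_cast
    linear_combination -(kappa m * inner ℂ f d) * hν
  have hκ := (kappa_pos m).le
  obtain ⟨cL, hcL⟩ := exists_ae_eq_exp_of_weak ws isOpen_Iio ordConnected_Iio subset_union_left
  obtain ⟨cR, hcR⟩ := exists_ae_eq_exp_of_weak ws isOpen_Ioi ordConnected_Ioi subset_union_right
  obtain ⟨dL, hdL⟩ := exists_ae_eq_exp_of_weak wt isOpen_Iio ordConnected_Iio subset_union_left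
  obtain ⟨dR, hdR⟩ := exists_ae_eq_exp_of_weak wt isOpen_Ioi ordConnected_Ioi subset_union_right
  simp only [neg_neg] at hdL hdR
  -- Square integrability excludes e^{-κx} on the left and e^{κx} on the right, so s lives on the
  -- right half-line and t on the left.
  have hcL0 := eq_zero_of_ae_eq_exp_left hκ hcL
  have hdR0 := eq_zero_of_ae_eq_exp_right hκ hdR
  have es : s = cR • (memLp_rightExp m L).toLp (rightExp m L) :=
    eq_smul_rightExp (by simpa [hcL0] using hcL) hcR
  have et : t = dL • (memLp_leftExp m L).toLp (leftExp m L) :=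
    eq_smul_leftExp hdL (by simpa [hdR0] using hdR)
  have hn : (normConst m L : ℂ) ≠ 0 := by exact_mod_cast (normConst_pos m L).ne'
  -- The coefficients come from u = ν*(s - t)/2, divided by the normalizing constant.
  refine ⟨-(conj ν * dL / (2 * normConst m L)), conj ν * cR / (2 * normConst m L), ?_⟩
  apply (WithLp.equiv 2 _).injective
  set EL := (memLp_leftExp m L).toLp (leftExp m L)
  set ER := (memLp_rightExp m L).toLp (rightExp m L)
  set n : ℂ := ((normConst m L : ℝ) : ℂ)
  have eu : u = (conj ν / 2) • (s - t) := by
    simp only [s, t]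
    match_scalars
    · linear_combination -hν
    · ring
  have ed : d = (1 / 2 : ℂ) • (s + t) := by
    simp only [s, t]
    match_scalars <;> ring
  refine Prod.ext ?_ ?_
  · change u = -(conj ν * dL / (2 * n)) • n • EL + (conj ν * cR / (2 * n)) • n • ER
    rw [eu, es, et]
    match_scalars <;> field_simp
  · change d = -(conj ν * dL / (2 * n)) • n • (-ν) • EL + (conj ν * cR / (2 * n)) • n • ν • ER
    rw [ed, es, et]
    match_scalars
    · field_simp
      linear_combination -cR * hν
    · field_simp
      linear_combination -dL * hν

end Adjoint

/-! ### Algebra of the boundary parameters -/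

section Algebra

theorem kappa_sq (m : ℝ) : kappa m ^ 2 = 1 + m ^ 2 := Real.sq_sqrt (by positivity)

theorem kappa_ne_zero (m : ℝ) : (kappa m : ℂ) ≠ 0 := by exact_mod_cast (kappa_pos m).ne'

theorem kappa_mul_mu (m : ℝ) : kappa m * mu m = 1 + I * m :=
  mul_div_cancel₀ _ (kappa_ne_zero m)

theorem kappa_mul_conj_mu (m : ℝ) : kappa m * conj (mu m) = 1 - I * m := by
  have := congrArg conj (kappa_mul_mu m)
  simpa [sub_eq_add_neg] using this

theorem mu_mul_conj (m : ℝ) : mu m * conj (mu m) = 1 := by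
  have h : (kappa m : ℂ) ^ 2 = 1 + (m : ℂ) ^ 2 := by exact_mod_cast kappa_sq m
  have h0 := kappa_ne_zero m
  refine mul_left_cancel₀ (pow_ne_zero 2 h0) ?_
  linear_combination kappa m * conj (mu m) * kappa_mul_mu m + (1 + I * m) * kappa_mul_conj_mu m
    - h - (m : ℂ) ^ 2 * Complex.I_mul_I

theorem mu_add_conj (m : ℝ) : mu m + conj (mu m) = 2 / kappa m := by
  rw [eq_div_iff (kappa_ne_zero m)]
  linear_combination kappa_mul_mu m + kappa_mul_conj_mu m

/-! ### Existence of the phase -/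

theorem cexp_I_mul_phase {w : ℂ} (hw : ‖w‖ = 1) :
    cexp (I * (toIcoMod Real.two_pi_pos 0 (arg w) : ℝ)) = w := by
  rw [toIcoMod]
  have h : I * ((arg w - toIcoDiv Real.two_pi_pos 0 (arg w) • (2 * Real.pi) : ℝ) : ℂ)
      = arg w * I - (toIcoDiv Real.two_pi_pos 0 (arg w) : ℤ) * (2 * Real.pi * I) := by
    push_cast [zsmul_eq_mul]
    ring
  rw [h, Complex.exp_sub, Complex.exp_int_mul_two_pi_mul_I, div_one]
  have := Complex.norm_mul_exp_arg_mul_I w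
  rwa [hw, ofReal_one, one_mul] at this

theorem norm_div_norm_self {w : ℂ} (hw : w ≠ 0) : ‖w / ‖w‖‖ = 1 := by
  rw [norm_div, Complex.norm_real, norm_norm, div_self (norm_ne_zero_iff.2 hw)]

/-- If `z * conj e` is real for a unit complex number `e`, then `z` is a real multiple of `e`. -/
theorem exists_real_mul_of_im_eq_zero {e z : ℂ} (he : e * conj e = 1)
    (h : (z * conj e).im = 0) : ∃ a : ℝ, z = e * a := by
  refine ⟨(z * conj e).re, ?_⟩
  have : (((z * conj e).re : ℝ) : ℂ) = z * conj e := Complex.ext rfl (by simp [h])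
  rw [this]
  linear_combination -z * he

/-- Having phase e means that rotation by e* makes α₁, α₄ real and α₂, α₃ purely imaginary; the
imaginary case reduces to the real one through -i z. -/
theorem InClass.isPhase_of_eq_mul {α : Fin 4 → ℂ} {e : ℂ} {θ : ℝ} (hθ : cexp (I * θ) = e)
    (he : e * conj e = 1) (h0 : (α 0 * conj e).im = 0) (h1 : (α 1 * conj e).re = 0)
    (h2 : (α 2 * conj e).re = 0) (h3 : (α 3 * conj e).im = 0) : IsPhase α θ := by
  have hI : ∀ z : ℂ, (z * conj e).re = 0 → ∃ a : ℝ, z = I * e * a := by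
    intro z hz
    obtain ⟨a, ha⟩ := exists_real_mul_of_im_eq_zero (z := -I * z) he (by
      rw [mul_assoc]
      simp only [neg_mul, neg_im, mul_im, I_re, I_im, zero_mul, one_mul, zero_add, mul_re] at hz ⊢
      linarith)
    exact ⟨a, by linear_combination I * ha + z * Complex.I_mul_I⟩
  obtain ⟨a0, e0⟩ := exists_real_mul_of_im_eq_zero he h0
  obtain ⟨a1, e1⟩ := hI _ h1
  obtain ⟨a2, e2⟩ := hI _ h2
  obtain ⟨a3, e3⟩ := exists_real_mul_of_im_eq_zero he h3
  subst hθ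
  exact ⟨![a0, a1, a2, a3], e0, e1, e2, e3⟩

theorem norm_mul_conj_of_norm_one {e : ℂ} (he : ‖e‖ = 1) : e * conj e = 1 := by
  rw [Complex.mul_conj, Complex.normSq_eq_norm_sq, he]
  simp

theorem InClass.isPhase_phase {α : Fin 4 → ℂ} (h : InClass α) : IsPhase α (phase α) := by
  have hone := h.one
  have hone' := h.one'
  by_cases h0 : α 0 = 0
  · have h2 : α 2 ≠ 0 := by
      rintro h2
      rw [h0, h2] at hone
      simp at hone
    set r := ‖α 2‖
    have hr : 0 < r := norm_pos_iff.2 h2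
    have hrC : (r : ℂ) ≠ 0 := by exact_mod_cast hr.ne'
    set e := -I * α 2 / r
    have hen : ‖e‖ = 1 := by
      rw [norm_div, norm_mul, norm_neg, Complex.norm_I, one_mul, Complex.norm_real, norm_norm,
        div_self hr.ne']
    have he := norm_mul_conj_of_norm_one hen
    have hθ : cexp (I * phase α) = e := by
      rw [phase, if_pos h0]
      exact cexp_I_mul_phase hen
    have ce : conj e = I * conj (α 2) / r := by simp [e]
    refine InClass.isPhase_of_eq_mul hθ he ?_ ?_ ?_ ?_
    · simp [h0]
    · rw [h0, zero_mul, zero_add] at hone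
      have : α 1 * conj e = ((1 / r : ℝ) : ℂ) * I := by
        rw [ce]
        push_cast
        field_simp
        linear_combination hone
      rw [this]
      simp
    · have : α 2 * conj e = ((r : ℝ) : ℂ) * I := by
        rw [ce]
        have h3 : α 2 * conj (α 2) = (r : ℂ) ^ 2 := by
          rw [Complex.mul_conj, Complex.normSq_eq_norm_sq]
          push_cast
          rfl
        field_simp
        linear_combination h3
      rw [this]
      simp
    · have : α 3 * conj e = ((1 / r : ℝ) : ℂ) * (I * conj (α 2 * conj (α 3))) := by
        rw [ce]
        push_cast
        simp only [map_mul, Complex.conj_conj]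
        ring
      rw [this, Complex.im_ofReal_mul]
      have := h.re34
      simp only [mul_im, I_re, I_im, conj_re, zero_mul, one_mul, zero_add]
      rw [this, mul_zero]
  · set r := ‖α 0‖
    have hr : 0 < r := norm_pos_iff.2 h0
    have hrC : (r : ℂ) ≠ 0 := by exact_mod_cast hr.ne'
    set e := α 0 / r
    have hen : ‖e‖ = 1 := norm_div_norm_self h0
    have he := norm_mul_conj_of_norm_one hen
    have hθ : cexp (I * phase α) = e := by
      rw [phase, if_neg h0]
      exact cexp_I_mul_phase hen
    have ce : ∀ z, z * conj e = ((1 / r : ℝ) : ℂ) * conj (α 0 * conj z) := fun z => by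
      simp [e]
      ring
    -- Comparing the two forms of the last condition in (C) shows that α₂α₃* is real; then so is
    -- α₁α₄*.
    have h23 : (α 1 * conj (α 2)).im = 0 := by
      have := congrArg Complex.im (hone.trans hone'.symm)
      simp only [add_im, mul_im, conj_re, conj_im] at this ⊢
      linarith
    refine InClass.isPhase_of_eq_mul hθ he ?_ ?_ ?_ ?_
    · rw [ce, Complex.im_ofReal_mul, Complex.mul_conj]
      simp
    · rw [ce, Complex.re_ofReal_mul, conj_re, h.re12, mul_zero]
    · rw [ce, Complex.re_ofReal_mul, conj_re, h.re13, mul_zero]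
    · rw [ce, Complex.im_ofReal_mul, conj_im]
      have := congrArg Complex.im hone
      rw [add_im, h23, add_zero, one_im] at this
      rw [this]
      simp

/-- The combination `α₁ + μ* α₂ + μ α₃ + α₄`. -/
noncomputable def tauOne (m : ℝ) (α : Fin 4 → ℂ) : ℂ := α 0 + conj (mu m) * α 1 + mu m * α 2 + α 3

theorem cexp_I_mul_conj (θ : ℝ) : cexp (I * θ) * conj (cexp (I * θ)) = 1 :=
  norm_mul_conj_of_norm_one (by rw [mul_comm]; exact Complex.norm_exp_ofReal_mul_I θ)

theorem cexp_shift (θ : ℝ) : cexp (I * (θ - Real.pi / 2)) = -I * cexp (I * θ) := by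
  rw [mul_sub, Complex.exp_sub, show I * (Real.pi / 2 : ℂ) = Real.pi / 2 * I by ring,
    Complex.exp_pi_div_two_mul_I, Complex.div_I]
  ring

theorem cexp_neg_shift (θ : ℝ) :
    cexp (-I * (θ - Real.pi / 2)) = I * conj (cexp (I * θ)) := by
  have h := congrArg conj (cexp_shift θ)
  rw [← Complex.exp_conj] at h
  simp only [map_mul, map_sub, map_neg, Complex.conj_I, Complex.conj_ofReal, map_div₀,
    map_ofNat, neg_neg] at h
  exact h

variable {m : ℝ} {α : Fin 4 → ℂ} {θ : ℝ}

/-- The relations between `α`, its phase and its conjugate. -/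
theorem IsPhase.relations (hα : InClass α) (h : IsPhase α θ) :
    conj (α 0) * cexp (I * θ) ^ 2 = α 0 ∧ conj (α 1) * cexp (I * θ) ^ 2 = -α 1 ∧
    conj (α 2) * cexp (I * θ) ^ 2 = -α 2 ∧ conj (α 3) * cexp (I * θ) ^ 2 = α 3 ∧
    cexp (I * θ) ^ 2 = α 0 * α 3 - α 1 * α 2 := by
  obtain ⟨a, h0, h1, h2, h3⟩ := h
  have he := cexp_I_mul_conj θ
  have hone := hα.one
  have hI := Complex.I_mul_I
  set e := cexp (I * θ)
  have c0 : conj (α 0) * e ^ 2 = α 0 := by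
    rw [h0]
    simp only [map_mul, Complex.conj_ofReal]
    linear_combination a 0 * e * he
  have c1 : conj (α 1) * e ^ 2 = -α 1 := by
    rw [h1]
    simp only [map_mul, Complex.conj_ofReal, Complex.conj_I]
    linear_combination -I * a 1 * e * he
  have c2 : conj (α 2) * e ^ 2 = -α 2 := by
    rw [h2]
    simp only [map_mul, Complex.conj_ofReal, Complex.conj_I]
    linear_combination -I * a 2 * e * he
  have c3 : conj (α 3) * e ^ 2 = α 3 := by
    rw [h3]
    simp only [map_mul, Complex.conj_ofReal]
    linear_combination a 3 * e * he
  refine ⟨c0, c1, c2, c3, ?_⟩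
  -- Multiplying α₁α₄* + α₂α₃* = 1 by e² and removing the conjugates leaves the determinant of B_α.
  linear_combination -e ^ 2 * hone + α 0 * c3 + α 1 * c2

/-- After multiplication by e² ≠ 0 no conjugate of α remains, and the claim is a polynomial identity
modulo μμ* = 1. It identifies Γ₀ with 1/|τ|. -/
theorem tauOne_mul_conj (m : ℝ) (hα : InClass α) (h : IsPhase α θ) :
    tauOne m α * conj (tauOne m α) =
      (2 / kappa m) ^ 2 + sigmaOne m α * conj (sigmaOne m α) := by
  obtain ⟨c0, c1, c2, c3, hE⟩ := h.relations hα
  have he0 : cexp (I * θ) ≠ 0 := Complex.exp_ne_zero _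
  have hM := mu_mul_conj m
  rw [← mu_add_conj]
  simp only [tauOne, sigmaOne, map_add, map_sub, map_mul, map_neg, Complex.conj_conj]
  set M := mu m
  set M' := conj M
  refine mul_right_cancel₀ (pow_ne_zero 2 he0) ?_
  have l : ∀ x : ℂ, x * (conj (α 0) + M * conj (α 1) + M' * conj (α 2) + conj (α 3)) *
      cexp (I * θ) ^ 2 = x * (α 0 - M * α 1 - M' * α 2 + α 3) := fun x => by
    linear_combination x * (c0 + M * c1 + M' * c2 + c3)
  have r : ∀ x : ℂ, x * (-M * conj (α 0) + conj (α 1) - conj (α 2) + M' * conj (α 3)) *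
      cexp (I * θ) ^ 2 = x * (-M * α 0 - α 1 + α 2 + M' * α 3) := fun x => by
    linear_combination x * (-M * c0 + c1 - c2 + M' * c3)
  rw [l, add_mul ((M + M') ^ 2), r, hE]
  grind

/-! ### Normalization of the γ's and the matrix built from them -/

theorem gamma_radicand_pos (m : ℝ) (α : Fin 4 → ℂ) :
    0 < 4 / (1 + m ^ 2) + ‖sigmaOne m α‖ ^ 2 := by positivity

theorem Gamma0_sq_mul (m : ℝ) (hα : InClass α) (h : IsPhase α θ) :
    (Gamma0 m α : ℂ) ^ 2 * (tauOne m α * conj (tauOne m α)) = 1 := by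
  have h1 : Gamma0 m α ^ 2 * (4 / (1 + m ^ 2) + ‖sigmaOne m α‖ ^ 2) = 1 := by
    have hp := gamma_radicand_pos m α
    rw [Gamma0, ← Real.rpow_natCast, ← Real.rpow_mul hp.le, show (-1 / 2 : ℝ) * (2 : ℕ) = -1 by
      norm_num, Real.rpow_neg_one, inv_mul_cancel₀ hp.ne']
  rw [tauOne_mul_conj m hα h, Complex.mul_conj, Complex.normSq_eq_norm_sq, div_pow]
  rw [← kappa_sq] at h1
  rw [← Complex.ofReal_one, ← h1]
  push_cast
  ring

theorem tauOne_ne_zero (m : ℝ) (hα : InClass α) (h : IsPhase α θ) : tauOne m α ≠ 0 := by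
  intro h0
  have := Gamma0_sq_mul m hα h
  rw [h0] at this
  simp at this

theorem gamma1_eq (m : ℝ) (α : Fin 4 → ℂ) (θ : ℝ) :
    gamma1 m α θ = Gamma0 m α * (I * conj (cexp (I * θ))) * sigmaOne m α := by
  rw [gamma1, cexp_neg_shift]

theorem gamma2_eq (m : ℝ) (α : Fin 4 → ℂ) (θ : ℝ) :
    gamma2 m α θ = (mu m + conj (mu m)) * Gamma0 m α * (I * conj (cexp (I * θ))) := by
  rw [gamma2, cexp_neg_shift, mu_add_conj]

theorem gamma3_eq (m : ℝ) (α : Fin 4 → ℂ) (θ : ℝ) :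
    gamma3 m α θ = Gamma0 m α * (-I * cexp (I * θ)) * mu m * conj (tauOne m α) := by
  rw [gamma3, cexp_shift, tauOne]

theorem gamma3_norm (m : ℝ) (hα : InClass α) (h : IsPhase α θ) :
    gamma3 m α θ * conj (gamma3 m α θ) = 1 := by
  have he := cexp_I_mul_conj θ
  have hΓ := Gamma0_sq_mul m hα h
  have hM := mu_mul_conj m
  have hI := Complex.I_mul_I
  rw [gamma3_eq]
  simp only [map_mul, map_neg, Complex.conj_I, Complex.conj_ofReal, Complex.conj_conj]
  set e := cexp (I * θ)
  set T := tauOne m α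
  calc _ = -(I * I) * (e * conj e) * (mu m * conj (mu m)) * ((Gamma0 m α : ℂ) ^ 2 * (T * conj T)) := by
        ring
    _ = 1 := by rw [he, hM, hΓ, hI]; ring

theorem gamma12_norm (m : ℝ) (hα : InClass α) (h : IsPhase α θ) :
    gamma1 m α θ * conj (gamma1 m α θ) + gamma2 m α θ * conj (gamma2 m α θ) = 1 := by
  have he := cexp_I_mul_conj θ
  have hΓ := Gamma0_sq_mul m hα h
  have hI := Complex.I_mul_I
  rw [tauOne_mul_conj m hα h, ← mu_add_conj] at hΓ
  rw [gamma1_eq, gamma2_eq]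
  simp only [map_mul, map_add, Complex.conj_I, Complex.conj_ofReal, Complex.conj_conj]
  set e := cexp (I * θ)
  calc _ = -(I * I) * (e * conj e) * ((Gamma0 m α : ℂ) ^ 2 *
        ((mu m + conj (mu m)) ^ 2 + sigmaOne m α * conj (sigmaOne m α))) := by ring
    _ = 1 := by rw [he, hΓ, hI]; ring

theorem norm_sq_eq_mul_conj (z : ℂ) : ((‖z‖ ^ 2 : ℝ) : ℂ) = z * conj z := by
  rw [Complex.mul_conj, Complex.normSq_eq_norm_sq]

theorem gamma2_ne_zero (m : ℝ) (hα : InClass α) (h : IsPhase α θ) : gamma2 m α θ ≠ 0 := by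
  have hΓ := Gamma0_sq_mul m hα h
  have h1 : (Gamma0 m α : ℂ) ≠ 0 := by
    intro h0
    rw [h0] at hΓ
    simp at hΓ
  exact mul_ne_zero (mul_ne_zero (div_ne_zero two_ne_zero (kappa_ne_zero m)) h1)
    (Complex.exp_ne_zero _)

theorem quatMatrix_mem_unitaryGroup {γ₁ γ₂ γ₃ : ℂ} (h12 : γ₁ * conj γ₁ + γ₂ * conj γ₂ = 1)
    (h3 : γ₃ * conj γ₃ = 1) : quatMatrix γ₁ γ₂ γ₃ ∈ Matrix.unitaryGroup (Fin 2) ℂ := by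
  rw [Matrix.mem_unitaryGroup_iff]
  ext i j
  fin_cases i <;> fin_cases j <;>
    simp [quatMatrix, Matrix.mul_apply, Fin.sum_univ_two, Matrix.star_apply]
  · linear_combination γ₃ * conj γ₃ * h12 + h3
  · ring
  · ring
  · linear_combination γ₃ * conj γ₃ * h12 + h3

theorem quatMatrix_not_isDiag {γ₁ γ₂ γ₃ : ℂ} (h2 : γ₂ ≠ 0) (h3 : γ₃ ≠ 0) :
    ¬ (quatMatrix γ₁ γ₂ γ₃).IsDiag := by
  intro h
  have := h (i := 1) (j := 0) (by decide)
  simp [quatMatrix, h2, h3] at this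

/-- The entries of the matrix `U_α`, multiplied by `α₁ + μ* α₂ + μ α₃ + α₄`. -/
theorem quatMatrix_entries (m : ℝ) (hα : InClass α) (h : IsPhase α θ)
    {U : Matrix (Fin 2) (Fin 2) ℂ}
    (hU : U = quatMatrix (gamma1 m α θ) (gamma2 m α θ) (gamma3 m α θ)) :
    U 0 0 * tauOne m α = mu m * sigmaOne m α ∧
    U 0 1 * tauOne m α = (mu m + conj (mu m)) * (α 0 * α 3 - α 1 * α 2) * mu m ∧
    U 1 0 * tauOne m α = (mu m + conj (mu m)) * mu m ∧
    U 1 1 * tauOne m α = mu m * (mu m * α 0 + α 1 - α 2 - conj (mu m) * α 3) := by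
  obtain ⟨c0, c1, c2, c3, hE⟩ := h.relations hα
  have he := cexp_I_mul_conj θ
  have hΓ := Gamma0_sq_mul m hα h
  have hI := Complex.I_mul_I
  have hs : conj (sigmaOne m α) * cexp (I * θ) ^ 2 =
      -(mu m * α 0 + α 1 - α 2 - conj (mu m) * α 3) := by
    simp only [sigmaOne, map_add, map_sub, map_mul, map_neg, Complex.conj_conj]
    linear_combination -mu m * c0 + c1 - c2 + conj (mu m) * c3
  rw [hU, gamma1_eq, gamma2_eq, gamma3_eq, quatMatrix]
  simp only [Matrix.smul_apply, Matrix.of_apply, Matrix.cons_val', Matrix.cons_val_zero,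
    Matrix.cons_val_one, Matrix.cons_val_fin_one, smul_eq_mul,
    map_mul, map_add, Complex.conj_I, Complex.conj_ofReal, Complex.conj_conj]
  rw [← hE]
  set e := cexp (I * θ)
  set T := tauOne m α
  set Γ : ℂ := ((Gamma0 m α : ℝ) : ℂ)
  set M := mu m
  -- Each entry carries the factor Γ₀² τ*, from γ₃ and one of γ₁, γ₂; multiplication by τ turns it
  -- into 1.
  refine ⟨?_, ?_, ?_, ?_⟩
  · calc _ = -(I * I) * (e * conj e) * (Γ ^ 2 * (T * conj T)) * M * sigmaOne m α := by ring
      _ = _ := by rw [he, hΓ, hI]; ring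
  · calc _ = -(I * I) * (Γ ^ 2 * (T * conj T)) * (M + conj M) * e ^ 2 * M := by ring
      _ = _ := by rw [hΓ, hI]; ring
  · calc _ = -(I * I) * (e * conj e) * (Γ ^ 2 * (T * conj T)) * (M + conj M) * M := by ring
      _ = _ := by rw [he, hΓ, hI]; ring
  · calc _ = (I * I) * (Γ ^ 2 * (T * conj T)) * M * (conj (sigmaOne m α) * e ^ 2) := by ring
      _ = _ := by rw [hs, hΓ, hI]; ring

/-- The boundary values of `ψ_L⁺ + U ψ_L⁺` and of `ψ_R⁺ + U ψ_R⁺` satisfy the boundary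
condition given by `B_α`. -/
theorem quatMatrix_boundary (m : ℝ) (hα : InClass α) (h : IsPhase α θ)
    {U : Matrix (Fin 2) (Fin 2) ℂ}
    (hU : U = quatMatrix (gamma1 m α θ) (gamma2 m α θ) (gamma3 m α θ)) :
    (U 0 1 = α 0 * (1 + U 0 0) + α 1 * (-mu m + conj (mu m) * U 0 0) ∧
      -conj (mu m) * U 0 1 = α 2 * (1 + U 0 0) + α 3 * (-mu m + conj (mu m) * U 0 0)) ∧
    (1 + U 1 1 = α 0 * U 1 0 + α 1 * (conj (mu m) * U 1 0) ∧
      mu m - conj (mu m) * U 1 1 = α 2 * U 1 0 + α 3 * (conj (mu m) * U 1 0)) := by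
  obtain ⟨e1, e2, e3, e4⟩ := quatMatrix_entries m hα h hU
  have hT := tauOne_ne_zero m hα h
  have hM := mu_mul_conj m
  have hTdef : tauOne m α = α 0 + conj (mu m) * α 1 + mu m * α 2 + α 3 := rfl
  have hσ : sigmaOne m α = -conj (mu m) * α 0 + α 1 - α 2 + mu m * α 3 := rfl
  rw [hσ] at e1
  refine ⟨⟨?_, ?_⟩, ?_, ?_⟩ <;> refine mul_right_cancel₀ hT ?_ <;> grind

/-- The boundary condition determines the entries of the matrix `U_α`. -/
theorem boundary_unique (hT : tauOne m α ≠ 0) {x y x' y' p q r : ℂ}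
    (h1 : p + y = α 0 * (q + x) + α 1 * (r + conj (mu m) * x))
    (h1' : p + y' = α 0 * (q + x') + α 1 * (r + conj (mu m) * x')) {p' : ℂ}
    (h2 : p' - conj (mu m) * y = α 2 * (q + x) + α 3 * (r + conj (mu m) * x))
    (h2' : p' - conj (mu m) * y' = α 2 * (q + x') + α 3 * (r + conj (mu m) * x')) :
    x = x' ∧ y = y' := by
  have hM := mu_mul_conj m
  have hx : x = x' := by
    -- Subtracting the primed equations and eliminating y - y' gives μ* τ (x - x') = 0.
    refine sub_eq_zero.1 ((mul_eq_zero.1 ?_).resolve_right hT)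
    have hTdef : tauOne m α = α 0 + conj (mu m) * α 1 + mu m * α 2 + α 3 := rfl
    rw [hTdef]
    grind
  subst hx
  exact ⟨rfl, add_left_cancel (h1.trans h1'.symm)⟩

end Algebra

/-! ### Boundary values -/

section Boundary

variable {m : ℝ} {L : ℝ≥0}

/-- Two continuous representatives agree on the open half-line, hence at its endpoint. So boundary
values depend only on the class in L²(Ω). -/
theorem HasACDeriv.boundary_unique {f g g' : L2 L} {FL FR FL' FR' : ℝ → ℂ}
    (h : HasACDeriv L f g FL FR) (h' : HasACDeriv L f g' FL' FR') :
    FL (-(L : ℝ)) = FL' (-(L : ℝ)) ∧ FR (L : ℝ) = FR' (L : ℝ) := by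
  constructor
  · have hL : EqOn FL FL' (Iio (-(L : ℝ))) := by
      refine eqOn_of_ae isOpen_Iio h.continuousOn_left h'.continuousOn_left ?_
      filter_upwards [h.eq_left, h'.eq_left] with x h1 h2 hx
      rw [← h1 hx, h2 hx]
    have hle : -(L : ℝ) - 1 ≤ -(L : ℝ) := by linarith
    have c1 := (h.ac_left _ hle).continuousOn
    have c2 := (h'.ac_left _ hle).continuousOn
    rw [uIcc_of_le hle] at c1 c2
    refine (hL.mono (Ico_subset_Iio_self (a := -(L : ℝ) - 1))).of_subset_closure c1 c2
      Ico_subset_Icc_self ?_ (right_mem_Icc.2 hle)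
    rw [closure_Ico (by linarith)]
  · have hR : EqOn FR FR' (Ioi (L : ℝ)) := by
      refine eqOn_of_ae isOpen_Ioi h.continuousOn_right h'.continuousOn_right ?_
      filter_upwards [h.eq_right, h'.eq_right] with x h1 h2 hx
      rw [← h1 hx, h2 hx]
    have hle : (L : ℝ) ≤ L + 1 := by linarith
    have c1 := (h.ac_right _ hle).continuousOn
    have c2 := (h'.ac_right _ hle).continuousOn
    rw [uIcc_of_le hle] at c1 c2
    refine (hR.mono (show Ioc (L : ℝ) (L + 1) ⊆ Ioi (L : ℝ) from Ioc_subset_Ioi_self)).of_subset_closure c1 c2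
      Ioc_subset_Icc_self ?_ (left_mem_Icc.2 hle)
    rw [closure_Ioc (by linarith)]

theorem HasBoundaryValues.unique {ψ : WaveSpace L} {vL vR vL' vR' : Fin 2 → ℂ}
    (h : HasBoundaryValues ψ vL vR) (h' : HasBoundaryValues ψ vL' vR') :
    vL = vL' ∧ vR = vR' := by
  obtain ⟨_, _, _, _, _, _, hu, hd, rfl, rfl⟩ := h
  obtain ⟨_, _, _, _, _, _, hu', hd', rfl, rfl⟩ := h'
  rw [(hu.boundary_unique hu').1, (hu.boundary_unique hu').2, (hd.boundary_unique hd').1,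
    (hd.boundary_unique hd').2]
  exact ⟨rfl, rfl⟩

theorem HasBoundaryValues.add {ψ φ : WaveSpace L} {vL vR wL wR : Fin 2 → ℂ}
    (h : HasBoundaryValues ψ vL vR) (h' : HasBoundaryValues φ wL wR) :
    HasBoundaryValues (ψ + φ) (vL + wL) (vR + wR) := by
  obtain ⟨_, _, _, _, _, _, hu, hd, rfl, rfl⟩ := h
  obtain ⟨_, _, _, _, _, _, hu', hd', rfl, rfl⟩ := h'
  exact ⟨_, _, _, _, _, _, hu.add hu', hd.add hd', by simp, by simp⟩

theorem HasBoundaryValues.smul {ψ : WaveSpace L} {vL vR : Fin 2 → ℂ} (c : ℂ)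
    (h : HasBoundaryValues ψ vL vR) : HasBoundaryValues (c • ψ) (c • vL) (c • vR) := by
  obtain ⟨_, _, _, _, _, _, hu, hd, rfl, rfl⟩ := h
  exact ⟨_, _, _, _, _, _, hu.smul c, hd.smul c, by simp, by simp⟩

theorem HasBoundaryValues.mem_maximalDirac (m : ℝ) {ψ : WaveSpace L} {vL vR : Fin 2 → ℂ}
    (h : HasBoundaryValues ψ vL vR) : ψ ∈ (maximalDirac m L).domain := by
  obtain ⟨_, _, _, _, _, _, hu, hd, _⟩ := h
  exact (maximalDirac_apply m hu hd).1

theorem mem_minimalDomain_iff {ψ : WaveSpace L} :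
    ψ ∈ minimalDomain L ↔ HasBoundaryValues ψ 0 0 := by
  constructor
  · rintro ⟨⟨_, _, _, hu, u1, u2⟩, ⟨_, _, _, hd, d1, d2⟩⟩
    refine ⟨_, _, _, _, _, _, hu, hd, ?_, ?_⟩
    · rw [u1, d1]; ext i; fin_cases i <;> rfl
    · rw [u2, d2]; ext i; fin_cases i <;> rfl
  · rintro ⟨_, _, _, _, _, _, hu, hd, e1, e2⟩
    exact ⟨⟨_, _, _, hu, (congrFun e1 0).symm, (congrFun e2 0).symm⟩,
      ⟨_, _, _, hd, (congrFun e1 1).symm, (congrFun e2 1).symm⟩⟩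

/-- The boundary value of the exponential states. -/
noncomputable def boundaryConst (m : ℝ) (L : ℝ≥0) : ℂ :=
  (normConst m L * Real.exp (-kappa m * L) : ℝ)

theorem boundaryConst_ne_zero (m : ℝ) (L : ℝ≥0) : boundaryConst m L ≠ 0 :=
  Complex.ofReal_ne_zero.2 (mul_pos (normConst_pos m L) (Real.exp_pos _)).ne'

theorem leftState_boundary (m : ℝ) (L : ℝ≥0) (w : ℂ) :
    HasBoundaryValues (leftState m L w) (boundaryConst m L • ![1, w]) 0 := by
  have he := hasACDeriv_leftExp m L
  refine ⟨_, _, _, _, _, _, he.smul (normConst m L : ℂ),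
    (he.smul w).smul (normConst m L : ℂ), ?_, ?_⟩
  · ext i
    fin_cases i <;> simp [boundaryConst]; ring
  · ext i
    fin_cases i <;> simp

theorem rightState_boundary (m : ℝ) (L : ℝ≥0) (w : ℂ) :
    HasBoundaryValues (rightState m L w) 0 (boundaryConst m L • ![1, w]) := by
  have he := hasACDeriv_rightExp m L
  refine ⟨_, _, _, _, _, _, he.smul (normConst m L : ℂ),
    (he.smul w).smul (normConst m L : ℂ), ?_, ?_⟩
  · ext i
    fin_cases i <;> simp
  · ext i
    fin_cases i <;> simp [boundaryConst]; ring

/-! ### Orthonormal bases of the deficiency subspaces -/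

theorem normConst_sq (m : ℝ) (L : ℝ≥0) :
    normConst m L ^ 2 = kappa m * Real.exp (2 * kappa m * L) := by
  rw [normConst, mul_pow, ← Real.rpow_natCast, ← Real.rpow_mul (by positivity), kappa,
    Real.sqrt_eq_rpow, ← Real.exp_nat_mul]
  congr 1
  · norm_num
  · push_cast
    ring_nf

theorem normConst_sq_mul_exp (m : ℝ) (L : ℝ≥0) :
    (normConst m L : ℂ) ^ 2 * (Real.exp (-kappa m * L) : ℂ) ^ 2 = kappa m := by
  have : normConst m L ^ 2 * Real.exp (-kappa m * L) ^ 2 = kappa m := by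
    rw [normConst_sq, ← Real.exp_nat_mul, mul_assoc, ← Real.exp_add]
    push_cast
    rw [show 2 * kappa m * L + 2 * (-kappa m * L) = 0 by ring, Real.exp_zero, mul_one]
  exact_mod_cast this

/-- Integration by parts of the exponential against itself: its derivative is κ times itself, so 2κ
times the squared norm is the boundary term. With N² e^{-2κΛ} = κ each spin component of a state
contributes 1/2 to its squared norm. -/
theorem inner_leftExp (m : ℝ) (L : ℝ≥0) :
    2 * kappa m * inner ℂ ((memLp_leftExp m L).toLp (leftExp m L))
      ((memLp_leftExp m L).toLp (leftExp m L)) = (Real.exp (-kappa m * L) : ℂ) ^ 2 := by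
  have he := hasACDeriv_leftExp m L
  have h := he.inner_add_inner he
  simp only [inner_smul_left, inner_smul_right, Complex.conj_ofReal, Pi.zero_apply, map_zero,
    zero_mul, sub_zero] at h
  rw [show kappa m * -(L : ℝ) = -kappa m * L by ring] at h
  linear_combination h

theorem inner_rightExp (m : ℝ) (L : ℝ≥0) :
    2 * kappa m * inner ℂ ((memLp_rightExp m L).toLp (rightExp m L))
      ((memLp_rightExp m L).toLp (rightExp m L)) = (Real.exp (-kappa m * L) : ℂ) ^ 2 := by
  have he := hasACDeriv_rightExp m L
  have h := he.inner_add_inner he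
  simp only [inner_smul_left, inner_smul_right, Complex.conj_ofReal, Pi.zero_apply, map_zero,
    map_neg, zero_mul, zero_sub] at h
  linear_combination -h

theorem inner_leftExp_rightExp (m : ℝ) (L : ℝ≥0) :
    inner ℂ ((memLp_leftExp m L).toLp (leftExp m L))
      ((memLp_rightExp m L).toLp (rightExp m L)) = 0 := by
  have e := hasACDeriv_leftExp m L
  have e' := hasACDeriv_rightExp m L
  rw [L2.inner_def]
  refine integral_eq_zero_of_ae ((ae_restrict_iff' (measurableSet_Omega L)).2 ?_)
  filter_upwards [e.eq_right, e'.eq_left] with x h1 h2 hx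
  rcases hx with hx | hx
  · rw [h2 hx, Pi.zero_apply, inner_zero_right]
  · rw [h1 hx, Pi.zero_apply, inner_zero_left]

theorem inner_leftState_self {w : ℂ} (hw : w * conj w = 1) :
    inner ℂ (leftState m L w) (leftState m L w) = (1 : ℂ) := by
  have h1 := inner_leftExp m L
  have h2 := normConst_sq_mul_exp m L
  rw [leftState, inner_smul_left, inner_smul_right, inner_waveSpace, inner_smul_left,
    inner_smul_right, Complex.conj_ofReal]
  set x := inner ℂ ((memLp_leftExp m L).toLp (leftExp m L))
      ((memLp_leftExp m L).toLp (leftExp m L))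
  refine mul_left_cancel₀ (kappa_ne_zero m) ?_
  linear_combination (normConst m L : ℂ) ^ 2 * h1 + h2 +
    kappa m * (normConst m L : ℂ) ^ 2 * x * hw

theorem inner_rightState_self {w : ℂ} (hw : w * conj w = 1) :
    inner ℂ (rightState m L w) (rightState m L w) = (1 : ℂ) := by
  have h1 := inner_rightExp m L
  have h2 := normConst_sq_mul_exp m L
  rw [rightState, inner_smul_left, inner_smul_right, inner_waveSpace, inner_smul_left,
    inner_smul_right, Complex.conj_ofReal]
  set x := inner ℂ ((memLp_rightExp m L).toLp (rightExp m L))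
      ((memLp_rightExp m L).toLp (rightExp m L))
  refine mul_left_cancel₀ (kappa_ne_zero m) ?_
  linear_combination (normConst m L : ℂ) ^ 2 * h1 + h2 +
    kappa m * (normConst m L : ℂ) ^ 2 * x * hw

theorem inner_leftState_rightState (m : ℝ) (L : ℝ≥0) (w w' : ℂ) :
    inner ℂ (leftState m L w) (rightState m L w') = (0 : ℂ) := by
  rw [leftState, rightState, inner_smul_left, inner_smul_right, inner_waveSpace, inner_smul_left,
    inner_smul_right, inner_leftExp_rightExp]
  simp

theorem inner_rightState_leftState (m : ℝ) (L : ℝ≥0) (w w' : ℂ) :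
    inner ℂ (rightState m L w) (leftState m L w') = (0 : ℂ) := by
  rw [← inner_conj_symm, inner_leftState_rightState, map_zero]

theorem exists_orthonormalBasis {z ν : ℂ} (hν : ν * conj ν = 1) (h1 : kappa m * ν = -I * (z - m))
    (h2 : kappa m * conj ν = -I * (z + m)) :
    ∃ b : OrthonormalBasis (Fin 2) ℂ (adjointEigenspace (minimalDirac m L) z),
      (b 0 : WaveSpace L) = leftState m L (-ν) ∧ (b 1 : WaveSpace L) = rightState m L ν := by
  have hν' : -ν * conj (-ν) = 1 := by simpa using hν
  set v : Fin 2 → adjointEigenspace (minimalDirac m L) z :=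
    ![⟨_, leftState_mem hν h1 h2⟩, ⟨_, rightState_mem hν h1 h2⟩]
  have hon : Orthonormal ℂ v := by
    rw [orthonormal_iff_ite]
    intro i j
    rw [Submodule.coe_inner]
    fin_cases i <;> fin_cases j
    · exact inner_leftState_self hν'
    · exact inner_leftState_rightState _ _ _ _
    · exact inner_rightState_leftState _ _ _ _
    · exact inner_rightState_self hν
  refine ⟨OrthonormalBasis.mk hon ?_, ?_, ?_⟩
  · rintro ⟨ψ, hψ⟩ -
    obtain ⟨a, b, rfl⟩ := exists_eq_of_mem_adjointEigenspace hν h1 h2 hψ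
    have : (⟨_, hψ⟩ : adjointEigenspace (minimalDirac m L) z) = a • v 0 + b • v 1 := rfl
    rw [this]
    exact Submodule.add_mem _ (Submodule.smul_mem _ _ (Submodule.subset_span ⟨0, rfl⟩))
      (Submodule.smul_mem _ _ (Submodule.subset_span ⟨1, rfl⟩))
  · rw [OrthonormalBasis.coe_mk]; rfl
  · rw [OrthonormalBasis.coe_mk]; rfl

/-- The basis obtained from an orthonormal basis by a unitary matrix. -/
theorem exists_orthonormalBasis_of_unitary {E : Type*} [NormedAddCommGroup E]
    [InnerProductSpace ℂ E] (b : OrthonormalBasis (Fin 2) ℂ E) {U : Matrix (Fin 2) (Fin 2) ℂ}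
    (hU : U ∈ Matrix.unitaryGroup (Fin 2) ℂ) :
    ∃ b' : OrthonormalBasis (Fin 2) ℂ E, ∀ i, b' i = U i 0 • b 0 + U i 1 • b 1 := by
  have hb := orthonormal_iff_ite.1 b.orthonormal
  have hon : Orthonormal ℂ fun i => U i 0 • b 0 + U i 1 • b 1 := by
    rw [orthonormal_iff_ite]
    intro i j
    -- The rows of U are orthonormal. The indices are swapped because the inner product is
    -- conjugate-linear in its first argument.
    have h := congrFun (congrFun (Matrix.mem_unitaryGroup_iff.1 hU) j) i
    rw [Matrix.mul_apply, Fin.sum_univ_two, Matrix.star_apply, Matrix.star_apply,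
      Matrix.one_apply] at h
    simp only [inner_add_left, inner_add_right, inner_smul_left, inner_smul_right, hb]
    simp only [Fin.isValue, ↓reduceIte, mul_one, zero_ne_one, one_ne_zero, mul_zero, add_zero,
      zero_add, eq_comm (a := i)]
    rw [← h]
    simp only [RCLike.star_def]
  refine ⟨OrthonormalBasis.mk hon (hon.linearIndependent.span_eq_top_of_card_eq_finrank ?_).ge,
    fun i => by rw [OrthonormalBasis.coe_mk]⟩
  exact (Module.finrank_eq_card_basis b.toBasis).symm

theorem exists_basis_plus (m : ℝ) (L : ℝ≥0) :
    ∃ b : OrthonormalBasis (Fin 2) ℂ (deficiencyPlus (minimalDirac m L)),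
      (b 0 : WaveSpace L) = psiLPlus m L ∧ (b 1 : WaveSpace L) = psiRPlus m L := by
  refine exists_orthonormalBasis (mu_mul_conj m) ?_ ?_
  · linear_combination kappa_mul_mu m + Complex.I_mul_I
  · linear_combination kappa_mul_conj_mu m + Complex.I_mul_I

theorem exists_basis_minus (m : ℝ) (L : ℝ≥0) :
    ∃ b : OrthonormalBasis (Fin 2) ℂ (deficiencyMinus (minimalDirac m L)),
      (b 0 : WaveSpace L) = psiLMinus m L ∧ (b 1 : WaveSpace L) = psiRMinus m L := by
  have h := exists_orthonormalBasis (m := m) (L := L) (z := -I) (ν := -conj (mu m)) ?_ ?_ ?_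
  · rwa [neg_neg] at h
  · rw [map_neg, Complex.conj_conj]
    linear_combination mu_mul_conj m
  · linear_combination -kappa_mul_conj_mu m - Complex.I_mul_I
  · rw [map_neg, Complex.conj_conj]
    linear_combination -kappa_mul_mu m - Complex.I_mul_I

theorem exists_eq_of_mem_plus (φ : deficiencyPlus (minimalDirac m L)) :
    ∃ a b : ℂ, (φ : WaveSpace L) = a • psiLPlus m L + b • psiRPlus m L := by
  obtain ⟨e, h0, h1⟩ := exists_basis_plus m L
  refine ⟨e.repr φ 0, e.repr φ 1, ?_⟩
  conv_lhs => rw [← e.sum_repr φ]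
  rw [Fin.sum_univ_two, Submodule.coe_add, Submodule.coe_smul, Submodule.coe_smul, h0, h1]

theorem exists_eq_of_mem_minus (φ : deficiencyMinus (minimalDirac m L)) :
    ∃ a b : ℂ, (φ : WaveSpace L) = a • psiLMinus m L + b • psiRMinus m L := by
  obtain ⟨e, h0, h1⟩ := exists_basis_minus m L
  refine ⟨e.repr φ 0, e.repr φ 1, ?_⟩
  conv_lhs => rw [← e.sum_repr φ]
  rw [Fin.sum_univ_two, Submodule.coe_add, Submodule.coe_smul, Submodule.coe_smul, h0, h1]

theorem psiLPlus_mem (m : ℝ) (L : ℝ≥0) : psiLPlus m L ∈ deficiencyPlus (minimalDirac m L) := by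
  obtain ⟨e, h0, -⟩ := exists_basis_plus m L
  exact h0 ▸ (e 0).2

theorem psiRPlus_mem (m : ℝ) (L : ℝ≥0) : psiRPlus m L ∈ deficiencyPlus (minimalDirac m L) := by
  obtain ⟨e, -, h1⟩ := exists_basis_plus m L
  exact h1 ▸ (e 1).2

/-! ### Unitary operators between the deficiency subspaces -/

variable {U : Matrix (Fin 2) (Fin 2) ℂ}
  {V : deficiencyPlus (minimalDirac m L) ≃ₗᵢ[ℂ] deficiencyMinus (minimalDirac m L)}

theorem HasMatrix.apply (hV : HasMatrix V U) {φ : deficiencyPlus (minimalDirac m L)} {a b : ℂ}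
    (hφ : (φ : WaveSpace L) = a • psiLPlus m L + b • psiRPlus m L) :
    (V φ : WaveSpace L) = a • (U 0 0 • psiLMinus m L + U 0 1 • psiRMinus m L) +
      b • (U 1 0 • psiLMinus m L + U 1 1 • psiRMinus m L) := by
  obtain ⟨⟨hl, el⟩, hr, er⟩ := hV
  have : φ = a • ⟨psiLPlus m L, hl⟩ + b • ⟨psiRPlus m L, hr⟩ := Subtype.ext hφ
  rw [this, map_add, map_smul, map_smul, Submodule.coe_add, Submodule.coe_smul,
    Submodule.coe_smul, el, er]

/-- The matrix prescribes the images of an orthonormal basis. They again form one because U is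
unitary, which gives existence; linearity gives uniqueness. -/
theorem existsUnique_hasMatrix (m : ℝ) (L : ℝ≥0) (hU : U ∈ Matrix.unitaryGroup (Fin 2) ℂ) :
    ∃! V : deficiencyPlus (minimalDirac m L) ≃ₗᵢ[ℂ] deficiencyMinus (minimalDirac m L),
      HasMatrix V U := by
  obtain ⟨e, e0, e1⟩ := exists_basis_plus m L
  obtain ⟨f, f0, f1⟩ := exists_basis_minus m L
  obtain ⟨g, hg⟩ := exists_orthonormalBasis_of_unitary f hU
  have hV : ∀ i, (e.equiv g (Equiv.refl _) (e i) : WaveSpace L) =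
      U i 0 • psiLMinus m L + U i 1 • psiRMinus m L := fun i => by
    rw [OrthonormalBasis.equiv_apply_basis, Equiv.refl_apply, hg, Submodule.coe_add,
      Submodule.coe_smul, Submodule.coe_smul, f0, f1]
  refine ⟨e.equiv g (Equiv.refl _), ⟨⟨psiLPlus_mem m L, ?_⟩, ⟨psiRPlus_mem m L, ?_⟩⟩, ?_⟩
  · rw [← hV 0]
    congr 2
    exact Subtype.ext e0.symm
  · rw [← hV 1]
    congr 2
    exact Subtype.ext e1.symm
  · intro W hW
    ext φ : 1
    obtain ⟨a, b, hφ⟩ := exists_eq_of_mem_plus φ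
    refine Subtype.ext ?_
    rw [hW.apply hφ]
    have : φ = a • e 0 + b • e 1 := Subtype.ext (by
      rw [hφ, Submodule.coe_add, Submodule.coe_smul, Submodule.coe_smul, e0, e1])
    rw [this, map_add, map_smul, map_smul, Submodule.coe_add, Submodule.coe_smul,
      Submodule.coe_smul, hV, hV]

/-- The boundary values of `φ + Uφ` for `φ = a ψ_L⁺ + b ψ_R⁺`. -/
theorem boundary_of_plus_add_minus (m : ℝ) (L : ℝ≥0) (a b p q : ℂ) :
    HasBoundaryValues ((a • psiLPlus m L + b • psiRPlus m L) +
        (p • psiLMinus m L + q • psiRMinus m L))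
      (boundaryConst m L • ![a + p, -mu m * a + conj (mu m) * p])
      (boundaryConst m L • ![b + q, mu m * b - conj (mu m) * q]) := by
  have h := (((leftState_boundary m L (-mu m)).smul a).add
    ((rightState_boundary m L (mu m)).smul b)).add
    (((leftState_boundary m L (conj (mu m))).smul p).add
    ((rightState_boundary m L (-conj (mu m))).smul q))
  refine (congrArg₂ (HasBoundaryValues _) ?_ ?_).mpr h
  · ext i
    fin_cases i <;> simp <;> ring
  · ext i
    fin_cases i <;> simp <;> ring

end Boundary

/-! ### Comparison of the domains -/

section Domains

variable {m : ℝ} {L : ℝ≥0} {α : Fin 4 → ℂ} {θ : ℝ} {U : Matrix (Fin 2) (Fin 2) ℂ}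
  {V : deficiencyPlus (minimalDirac m L) ≃ₗᵢ[ℂ] deficiencyMinus (minimalDirac m L)}

theorem boundaryMatrix_mulVec (α : Fin 4 → ℂ) (c x y : ℂ) :
    (boundaryMatrix α).mulVec (c • ![x, y]) = c • ![α 0 * x + α 1 * y, α 2 * x + α 3 * y] := by
  rw [Matrix.mulVec_smul]
  congr 1
  ext i
  fin_cases i <;> simp [boundaryMatrix, Matrix.mulVec, dotProduct, Fin.sum_univ_two]

/-- Membership in D(H₀*) is automatic for a function with boundary values, so only the boundary
condition remains. -/
theorem mem_alphaDomain_iff {ψ : WaveSpace L} :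
    ψ ∈ alphaDomain m L α ↔
      ∃ vL, HasBoundaryValues ψ vL ((boundaryMatrix α).mulVec vL) := by
  constructor
  · rintro ⟨-, vL, _, h, rfl⟩
    exact ⟨vL, h⟩
  · rintro ⟨vL, h⟩
    exact ⟨h.mem_maximalDirac m, vL, _, h, rfl⟩

theorem boundary_of_hasMatrix (hV : HasMatrix V U) {φ : deficiencyPlus (minimalDirac m L)}
    {a b : ℂ} (hφ : (φ : WaveSpace L) = a • psiLPlus m L + b • psiRPlus m L) :
    HasBoundaryValues ((φ : WaveSpace L) + (V φ : WaveSpace L))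
      (boundaryConst m L • ![a + (a * U 0 0 + b * U 1 0),
        -mu m * a + conj (mu m) * (a * U 0 0 + b * U 1 0)])
      (boundaryConst m L • ![b + (a * U 0 1 + b * U 1 1),
        mu m * b - conj (mu m) * (a * U 0 1 + b * U 1 1)]) := by
  have h := boundary_of_plus_add_minus m L a b (a * U 0 0 + b * U 1 0) (a * U 0 1 + b * U 1 1)
  rw [hV.apply hφ, hφ]
  convert h using 2
  module

/-- For the harder inclusion, choose φ so that φ + Vφ has the same left boundary value as ψ. Both
satisfy the condition given by B_α, so the right values agree too, and the difference lies in D(H₀).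
-/
theorem vonNeumannDomain_eq_alphaDomain (hα : InClass α) (h : IsPhase α θ)
    (hU : U = quatMatrix (gamma1 m α θ) (gamma2 m α θ) (gamma3 m α θ)) (hV : HasMatrix V U) :
    vonNeumannDomain (minimalDirac m L) V = alphaDomain m L α := by
  obtain ⟨⟨b1, b2⟩, b3, b4⟩ := quatMatrix_boundary m hα h hU
  have hB : ∀ a b : ℂ, boundaryConst m L • ![b + (a * U 0 1 + b * U 1 1),
        mu m * b - conj (mu m) * (a * U 0 1 + b * U 1 1)] =
      (boundaryMatrix α).mulVec (boundaryConst m L • ![a + (a * U 0 0 + b * U 1 0),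
        -mu m * a + conj (mu m) * (a * U 0 0 + b * U 1 0)]) := by
    intro a b
    rw [boundaryMatrix_mulVec]
    congr 1
    ext i
    fin_cases i
    · change b + (a * U 0 1 + b * U 1 1) = α 0 * _ + α 1 * _
      linear_combination a * b1 + b * b3
    · change mu m * b - conj (mu m) * (a * U 0 1 + b * U 1 1) = α 2 * _ + α 3 * _
      linear_combination a * b2 + b * b4
  ext ψ
  rw [mem_alphaDomain_iff]
  constructor
  · rintro ⟨ψ₀, h₀, φ, rfl⟩
    obtain ⟨a, b, hφ⟩ := exists_eq_of_mem_plus φ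
    have e := (mem_minimalDomain_iff.1 h₀).add (boundary_of_hasMatrix hV hφ)
    rw [zero_add, zero_add, hB, ← add_assoc] at e
    exact ⟨_, e⟩
  · rintro ⟨vL, hv⟩
    have hu : U 1 0 ≠ 0 := by
      intro h0
      have e3 := (quatMatrix_entries m hα h hU).2.2.1
      have hM := mu_mul_conj m
      rw [h0, zero_mul, mu_add_conj] at e3
      have hmu : mu m ≠ 0 := left_ne_zero_of_mul_eq_one hM
      exact mul_ne_zero (div_ne_zero two_ne_zero (kappa_ne_zero m)) hmu e3.symm
    have hc : mu m + conj (mu m) ≠ 0 := by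
      rw [mu_add_conj]
      exact div_ne_zero two_ne_zero (kappa_ne_zero m)
    have hβ := boundaryConst_ne_zero m L
    obtain ⟨a, b, hab⟩ : ∃ a b : ℂ, vL = boundaryConst m L • ![a + (a * U 0 0 + b * U 1 0),
        -mu m * a + conj (mu m) * (a * U 0 0 + b * U 1 0)] := by
      set x := vL 0 / boundaryConst m L
      set y := vL 1 / boundaryConst m L
      -- For x = a + p and y = -μa + μ*p, the combination μ*x - y eliminates p and determines a.
      -- Then p = x - a is solved for b, which needs u₂₁ ≠ 0.
      set a := (conj (mu m) * x - y) / (mu m + conj (mu m))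
      have ha : (mu m + conj (mu m)) * a = conj (mu m) * x - y := mul_div_cancel₀ _ hc
      refine ⟨a, (x - a - a * U 0 0) / U 1 0, ?_⟩
      have hb : a + (a * U 0 0 + (x - a - a * U 0 0) / U 1 0 * U 1 0) = x := by
        rw [div_mul_cancel₀ _ hu]
        ring
      have hb' : a * U 0 0 + (x - a - a * U 0 0) / U 1 0 * U 1 0 = x - a :=
        eq_sub_of_add_eq' hb
      ext i
      fin_cases i
      · change vL 0 = boundaryConst m L * (a + _)
        rw [hb, mul_div_cancel₀ _ hβ]
      · change vL 1 = boundaryConst m L * (-mu m * a + conj (mu m) * _)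
        rw [hb', show -mu m * a + conj (mu m) * (x - a) = y by linear_combination -ha,
          mul_div_cancel₀ _ hβ]
    set φ : deficiencyPlus (minimalDirac m L) :=
      a • ⟨psiLPlus m L, psiLPlus_mem m L⟩ + b • ⟨psiRPlus m L, psiRPlus_mem m L⟩
    have hφ : (φ : WaveSpace L) = a • psiLPlus m L + b • psiRPlus m L := rfl
    have e := hv.add ((boundary_of_hasMatrix hV hφ).smul (-1))
    rw [hB, ← hab, neg_one_smul, neg_one_smul, neg_one_smul, add_neg_cancel, add_neg_cancel] at e
    exact ⟨_, mem_minimalDomain_iff.2 e, φ, by abel⟩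

/-- Since φ + Vφ belongs to D(H_α), the coordinates of Vψ_L⁺ and Vψ_R⁺ satisfy the same linear
equations as the rows of U, and these have one solution because τ ≠ 0. -/
theorem hasMatrix_of_vonNeumannDomain_eq (hα : InClass α) (h : IsPhase α θ)
    (hU : U = quatMatrix (gamma1 m α θ) (gamma2 m α θ) (gamma3 m α θ))
    (hV : vonNeumannDomain (minimalDirac m L) V = alphaDomain m L α) : HasMatrix V U := by
  obtain ⟨⟨b1, b2⟩, b3, b4⟩ := quatMatrix_boundary m hα h hU
  have hT := tauOne_ne_zero m hα h
  have hβ := boundaryConst_ne_zero m L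
  have key : ∀ (φ : deficiencyPlus (minimalDirac m L)) (a b p q : ℂ),
      (φ : WaveSpace L) = a • psiLPlus m L + b • psiRPlus m L →
      (V φ : WaveSpace L) = p • psiLMinus m L + q • psiRMinus m L →
      b + q = α 0 * (a + p) + α 1 * (-mu m * a + conj (mu m) * p) ∧
      mu m * b - conj (mu m) * q = α 2 * (a + p) + α 3 * (-mu m * a + conj (mu m) * p) := by
    intro φ a b p q hφ hVφ
    have hmem : (φ : WaveSpace L) + (V φ : WaveSpace L) ∈
        vonNeumannDomain (minimalDirac m L) V :=
      ⟨0, Submodule.zero_mem _, φ, by rw [zero_add]⟩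
    rw [hV, mem_alphaDomain_iff] at hmem
    obtain ⟨vL, hv⟩ := hmem
    have hb := boundary_of_plus_add_minus m L a b p q
    rw [← hφ, ← hVφ] at hb
    obtain ⟨eL, eR⟩ := hv.unique hb
    rw [eL, boundaryMatrix_mulVec] at eR
    have eR' := smul_right_injective _ hβ eR
    exact ⟨(congrFun eR' 0).symm, (congrFun eR' 1).symm⟩
  refine ⟨⟨psiLPlus_mem m L, ?_⟩, ⟨psiRPlus_mem m L, ?_⟩⟩
  · obtain ⟨p, q, e⟩ := exists_eq_of_mem_minus (V ⟨_, psiLPlus_mem m L⟩)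
    obtain ⟨k1, k2⟩ := key _ 1 0 p q (by rw [one_smul, zero_smul, add_zero]) e
    -- Up to the common factor, (q, r) and (p, p') are the left and right boundary values of ψ_L⁺:
    -- (1, -μ) and (0, 0). For ψ_R⁺ they are (0, 0) and (1, μ).
    obtain ⟨rfl, rfl⟩ := boundary_unique (m := m) (α := α) hT (p := 0) (q := 1) (r := -mu m)
      (p' := 0) (x := p) (y := q) (x' := U 0 0) (y' := U 0 1) (by linear_combination k1)
      (by linear_combination b1) (by linear_combination k2) (by linear_combination b2)
    exact e
  · obtain ⟨p, q, e⟩ := exists_eq_of_mem_minus (V ⟨_, psiRPlus_mem m L⟩)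
    obtain ⟨k1, k2⟩ := key _ 0 1 p q (by rw [one_smul, zero_smul, zero_add]) e
    obtain ⟨rfl, rfl⟩ := boundary_unique (m := m) (α := α) hT (p := 1) (q := 0) (r := 0)
      (p' := mu m) (x := p) (y := q) (x' := U 1 0) (y' := U 1 1) (by linear_combination k1)
      (by linear_combination b3) (by linear_combination k2) (by linear_combination b4)
    exact e

end Domains

end DiracJunction

/-! ### The proposition -/

theorem mainTheorem5 (m : ℝ) (hm : 0 ≤ m) (L : NNReal) (α : Fin 4 → ℂ)
    (hα : DiracJunction.InClass α) :
    (DiracJunction.phase α ∈ Set.Ico 0 (2 * Real.pi) ∧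
      DiracJunction.IsPhase α (DiracJunction.phase α)) ∧
    ∀ θ : ℝ, DiracJunction.IsPhase α θ →
      ∀ γ₁ γ₂ γ₃ : ℂ, γ₁ = DiracJunction.gamma1 m α θ → γ₂ = DiracJunction.gamma2 m α θ →
        γ₃ = DiracJunction.gamma3 m α θ →
        (‖γ₁‖ ^ 2 + ‖γ₂‖ ^ 2 = 1 ∧ ‖γ₃‖ = 1 ∧ γ₂ ≠ 0) ∧
        (DiracJunction.quatMatrix γ₁ γ₂ γ₃ ∈ Matrix.unitaryGroup (Fin 2) ℂ ∧
          ¬ (DiracJunction.quatMatrix γ₁ γ₂ γ₃).IsDiag) ∧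
        (∃! V : DiracJunction.deficiencyPlus (DiracJunction.minimalDirac m L) ≃ₗᵢ[ℂ]
            DiracJunction.deficiencyMinus (DiracJunction.minimalDirac m L),
          DiracJunction.HasMatrix V (DiracJunction.quatMatrix γ₁ γ₂ γ₃)) ∧
        ∀ V : DiracJunction.deficiencyPlus (DiracJunction.minimalDirac m L) ≃ₗᵢ[ℂ]
            DiracJunction.deficiencyMinus (DiracJunction.minimalDirac m L),
          DiracJunction.vonNeumannDomain (DiracJunction.minimalDirac m L) V =
              DiracJunction.alphaDomain m L α ↔
            DiracJunction.HasMatrix V (DiracJunction.quatMatrix γ₁ γ₂ γ₃) := by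
  open DiracJunction in
  refine ⟨⟨?_, hα.isPhase_phase⟩, ?_⟩
  · have := toIcoMod_mem_Ico Real.two_pi_pos 0
      (arg (if α 0 = 0 then -I * α 2 / ‖α 2‖ else α 0 / ‖α 0‖))
    rwa [zero_add] at this
  rintro θ hθ _ _ _ rfl rfl rfl
  have h12 := gamma12_norm m hα hθ
  have h3 := gamma3_norm m hα hθ
  have h3n : ‖gamma3 m α θ‖ = 1 := by
    rw [← norm_sq_eq_mul_conj] at h3
    have h3' : ‖gamma3 m α θ‖ ^ 2 = 1 := by exact_mod_cast h3
    exact (pow_eq_one_iff_of_nonneg (norm_nonneg _) two_ne_zero).1 h3'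
  have h2 := gamma2_ne_zero m hα hθ
  have hU := quatMatrix_mem_unitaryGroup h12 h3
  -- Equality of the domains is equivalent to having the matrix U, so unique existence for the
  -- matrix carries over to the domain.
  refine ⟨⟨?_, h3n, h2⟩, ⟨hU, quatMatrix_not_isDiag h2 (left_ne_zero_of_mul_eq_one h3)⟩,
    existsUnique_hasMatrix m L hU, fun V => ⟨hasMatrix_of_vonNeumannDomain_eq hα hθ rfl,
      vonNeumannDomain_eq_alphaDomain hα hθ rfl⟩⟩
  rw [← norm_sq_eq_mul_conj, ← norm_sq_eq_mul_conj] at h12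
  exact_mod_cast h12
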